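/- **Conventions.** Let $X$ be a metric space with a base point $o$. The Gromov product is $(x|y)=\frac12\bigl(d(x,o)+d(y,o)-d(x,y)\bigr)$, and $X$ is Gromov-hyperbolic if there is $\delta\ge 0$ with $(x|z)\ge\min\{(x|y),(y|z)\}-\delta$ for all $x,y,z\in X$. For such $X$: - The boundary $\partial X$ is the set of sequences $(x_i)$ in $X$ with $\lim_{i,j\to\infty}(x_i|x_j)=\infty$, modulo $(x_i)\sim(y_j)\iff\lim_{i,j\to\infty}(x_i|y_j)=\infty$. For $A\subseteq X$, $\partial A\subseteq\partial X$ is the set of classes of such sequences with values in $A$. The product extends to $\overline X=X\cup\partial X$ by $(\xi|\eta)=\sup_{x_i\to\xi,\,y_j\to\eta}\liminf_{i,j\to\infty}(x_i|y_j)$, the supremum being over sequences in $X$. The space $\overline X$ has the topology in which the open balls of $X$ centred at $x$ form a neighbourhood basis at each $x\in X$, and the sets $\{x\in\overline X : (x|\xi)>-\log r\}$, $r>0$, form a neighbourhood basis at each $\xi\in\partial X$. - For $P\subseteq X$, the critical exponent is $\delta_P=\limsup_{n\to\infty}\frac1n\log\#(B(o,n)\cap P)\in[-\infty,\infty]$.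 A set $S\subseteq X$ is separated if there is $\varepsilon>0$ with $d(x,y)>\varepsilon$ for all distinct $x,y\in S$. The entropy is $h_P=\sup_S\delta_{P\cap S}$ over all separated $S\subseteq X$ (and $h_\emptyset=0$). - A semigroup of isometries is a subset $\Gamma$ of the group $\mathrm{Isom}(X)$ of bijective isometries that is closed under composition. Put $\delta_\Gamma=\delta_{\Gamma o}$, $h_\Gamma=h_{\Gamma o}$, and let the limit set be $\Lambda_\Gamma=\partial(\Gamma o)$. - Subsets $A,B$ of $X$ are Gromov-disjoint if their closures in $X$ are disjoint and there is a constant $C>0$ with $(a|b)<C$ for all $a\in A$, $b\in B$. A semigroup $\Gamma'$ of isometries is a Schottky semigroup if there are a set $X_+\subseteq X$ and a finite non-empty set $\{g_1,\dots,g_n\}$ of (distinct) isometries generating $\Gamma'$ as a semigroup such that $g_1X_+,\dots,g_nX_+$ and $X\setminus X_+$ are pairwise Gromov-disjoint and $X_+\setminus(g_1X_+\cup\dots\cup g_nX_+)$ has non-empty interior. **Theorem.** Let $X$ be a Gromov-hyperbolic space with base point $o$ such that $\overline X$ is compact, and let $\Gamma$ be a semigroup of isometries of $X$ whose limit set $\Lambda_\Gamma$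 contains at least two points. Then $$\sup_{\Gamma'\subseteq\Gamma,\ \Gamma'\text{ a Schottky semigroup}}\delta_{\Gamma'}=h_\Gamma ,$$ an equality in $[-\infty,\infty]$. -/

import Mathlib

open Filter Topology

namespace GromovHyp

/-- The Gromov product `(x|y)` with respect to the base point `o`. -/
noncomputable def gromovProduct {X : Type*} [MetricSpace X] (o x y : X) : ℝ :=
  (dist x o + dist y o - dist x y) / 2

/-- The space `X` (with base point `o`) is Gromov-hyperbolic. -/
def IsGromovHyperbolic {X : Type*} [MetricSpace X] (o : X) : Prop :=
  ∃ δ : ℝ, 0 ≤ δ ∧ ∀ x y z : X,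
    min (gromovProduct o x y) (gromovProduct o y z) - δ ≤ gromovProduct o x z

/-! ### The Gromov boundary -/

/-- Convergent sequences: those with `(x_i | x_j) → ∞` as `i, j → ∞`. -/
def ConvergentSeq {X : Type*} [MetricSpace X] (o : X) : Type _ :=
  {u : ℕ → X // Tendsto (fun p : ℕ × ℕ => gromovProduct o (u p.1) (u p.2)) atTop atTop}

/-- Two convergent sequences are equivalent when `(x_i | y_j) → ∞` as `i, j → ∞`. -/
def SeqEquiv {X : Type*} [MetricSpace X] (o : X) (u v : ConvergentSeq o) : Prop :=
  Tendsto (fun p : ℕ × ℕ => gromovProduct o (u.1 p.1) (v.1 p.2)) atTop atTop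

/-- The Gromov boundary `∂X`: convergent sequences up to equivalence. When `X` is
Gromov-hyperbolic, `SeqEquiv o` is an equivalence relation (`seqEquiv_equivalence`). -/
def GromovBoundary {X : Type*} [MetricSpace X] (o : X) : Type _ :=
  Quot (SeqEquiv o)

theorem gromovProduct_comm {X : Type*} [MetricSpace X] (o x y : X) :
    gromovProduct o x y = gromovProduct o y x := by
  unfold gromovProduct
  rw [dist_comm x y]
  ring

theorem seqEquiv_equivalence {X : Type*} [MetricSpace X] {o : X} (hX : IsGromovHyperbolic o) :
    Equivalence (SeqEquiv o) := by
  refine ⟨fun u => u.2, ?_, ?_⟩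
  · intro u v h
    unfold SeqEquiv at h ⊢
    rw [tendsto_atTop] at h ⊢
    intro b
    obtain ⟨⟨i, j⟩, hij⟩ := eventually_atTop.1 (h b)
    refine eventually_atTop.2 ⟨(j, i), fun p hp => ?_⟩
    rw [gromovProduct_comm]
    exact hij (p.2, p.1) ⟨hp.2, hp.1⟩
  · intro u v w huv hvw
    obtain ⟨δ, -, hδ⟩ := hX
    unfold SeqEquiv at huv hvw ⊢
    rw [tendsto_atTop] at huv hvw ⊢
    intro b
    obtain ⟨⟨i, j⟩, h₁⟩ := eventually_atTop.1 (huv (b + δ))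
    obtain ⟨⟨k, l⟩, h₂⟩ := eventually_atTop.1 (hvw (b + δ))
    refine eventually_atTop.2 ⟨(i, l), fun p hp => ?_⟩
    have e₁ := h₁ (p.1, max j k) ⟨hp.1, le_max_left _ _⟩
    have e₂ := h₂ (max j k, p.2) ⟨le_max_right _ _, hp.2⟩
    have e₃ := hδ (u.1 p.1) (v.1 (max j k)) (w.1 p.2)
    have e₄ := le_min e₁ e₂
    simp only at e₄
    linarith

theorem gromovBoundary_mk_eq_iff {X : Type*} [MetricSpace X] {o : X}
    (hX : IsGromovHyperbolic o) (u v : ConvergentSeq o) :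
    (Quot.mk (SeqEquiv o) u : GromovBoundary o) = Quot.mk (SeqEquiv o) v ↔ SeqEquiv o u v :=
  (seqEquiv_equivalence hX).quot_mk_eq_iff u v

/-- The boundary `∂A ⊆ ∂X` of a subset `A` of `X`: the boundary points represented by a
convergent sequence of points of `A`. -/
def boundaryOf {X : Type*} [MetricSpace X] (o : X) (A : Set X) : Set (GromovBoundary o) :=
  {ξ | ∃ u : ConvergentSeq o, (∀ n, u.1 n ∈ A) ∧ Quot.mk (SeqEquiv o) u = ξ}

/-! ### The Gromov closure and its topology -/

/-- The Gromov closure `X ∪ ∂X` of `X`. -/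
inductive GromovClosure {X : Type*} [MetricSpace X] (o : X) : Type _
  | pt (x : X) : GromovClosure o
  | bdry (ξ : GromovBoundary o) : GromovClosure o

/-- Convergence of a sequence of points of `X` to a point of `X ∪ ∂X`. -/
def SeqTendsTo {X : Type*} [MetricSpace X] {o : X} (u : ℕ → X) : GromovClosure o → Prop
  | .pt x => Tendsto u atTop (𝓝 x)
  | .bdry ξ => ∃ v : ConvergentSeq o, v.1 = u ∧ Quot.mk (SeqEquiv o) v = ξ

/-- The Gromov product on `X ∪ ∂X`:
`(ξ|η) = sup_{x_i → ξ, y_j → η} liminf_{i, j → ∞} (x_i | y_j)`. -/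
noncomputable def extendedProduct {X : Type*} [MetricSpace X] {o : X}
    (ξ η : GromovClosure o) : EReal :=
  ⨆ (u : ℕ → X) (v : ℕ → X) (_ : SeqTendsTo u ξ) (_ : SeqTendsTo v η),
    liminf (fun p : ℕ × ℕ => ((gromovProduct o (u p.1) (v p.2) : ℝ) : EReal)) atTop

/-- The ball `β(ξ, r) = {x ∈ X ∪ ∂X | (x|ξ) > - log r}` around a boundary point `ξ`. -/
def boundaryBall {X : Type*} [MetricSpace X] {o : X} (ξ : GromovBoundary o) (r : ℝ) :
    Set (GromovClosure o) :=
  {x | ((-Real.log r : ℝ) : EReal) < extendedProduct x (.bdry ξ)}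

theorem boundaryBall_mono {X : Type*} [MetricSpace X] {o : X} (ξ : GromovBoundary o)
    {r s : ℝ} (hr : 0 < r) (hrs : r ≤ s) : boundaryBall ξ r ⊆ boundaryBall ξ s := by
  intro x hx
  have h : ((-Real.log s : ℝ) : EReal) ≤ ((-Real.log r : ℝ) : EReal) :=
    EReal.coe_le_coe (neg_le_neg (Real.log_le_log hr hrs))
  exact h.trans_lt hx

/-- The topology of `X ∪ ∂X`: the balls `B(x, r)` of `X` are a neighbourhood basis at `x ∈ X`,
and the balls `β(ξ, r)` are a neighbourhood basis at `ξ ∈ ∂X`. -/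
instance instTopologicalSpaceGromovClosure {X : Type*} [MetricSpace X] (o : X) :
    TopologicalSpace (GromovClosure o) where
  IsOpen U :=
    (∀ x : X, GromovClosure.pt x ∈ U →
      ∃ r : ℝ, 0 < r ∧ GromovClosure.pt '' Metric.ball x r ⊆ U) ∧
    (∀ ξ : GromovBoundary o, GromovClosure.bdry ξ ∈ U →
      ∃ r : ℝ, 0 < r ∧ boundaryBall ξ r ⊆ U)
  isOpen_univ := ⟨fun _ _ => ⟨1, one_pos, Set.subset_univ _⟩,
    fun _ _ => ⟨1, one_pos, Set.subset_univ _⟩⟩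
  isOpen_inter := by
    rintro U V ⟨hU₁, hU₂⟩ ⟨hV₁, hV₂⟩
    refine ⟨fun x hx => ?_, fun ξ hξ => ?_⟩
    · obtain ⟨r, hr, h⟩ := hU₁ x hx.1
      obtain ⟨s, hs, k⟩ := hV₁ x hx.2
      exact ⟨min r s, lt_min hr hs, Set.subset_inter
        ((Set.image_mono (Metric.ball_subset_ball (min_le_left r s))).trans h)
        ((Set.image_mono (Metric.ball_subset_ball (min_le_right r s))).trans k)⟩
    · obtain ⟨r, hr, h⟩ := hU₂ ξ hξ.1
      obtain ⟨s, hs, k⟩ := hV₂ ξ hξ.2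
      exact ⟨min r s, lt_min hr hs, Set.subset_inter
        ((boundaryBall_mono ξ (lt_min hr hs) (min_le_left r s)).trans h)
        ((boundaryBall_mono ξ (lt_min hr hs) (min_le_right r s)).trans k)⟩
  isOpen_sUnion := by
    intro 𝒰 h
    refine ⟨fun x hx => ?_, fun ξ hξ => ?_⟩
    · obtain ⟨U, hU, hxU⟩ := hx
      obtain ⟨r, hr, k⟩ := (h U hU).1 x hxU
      exact ⟨r, hr, k.trans (Set.subset_sUnion_of_mem hU)⟩
    · obtain ⟨U, hU, hξU⟩ := hξ
      obtain ⟨r, hr, k⟩ := (h U hU).2 ξ hξU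
      exact ⟨r, hr, k.trans (Set.subset_sUnion_of_mem hU)⟩

/-! ### Critical exponent and entropy -/

/-- The critical exponent `limsup (1/n) log #(B(o, n) ∩ P)` of a subset `P` of `X`, in
`[-∞, ∞]` (with `log 0 = -∞` and `log ∞ = ∞`). -/
noncomputable def criticalExponent {X : Type*} [MetricSpace X] (o : X) (P : Set X) : EReal :=
  limsup (fun n : ℕ =>
    ENNReal.log (((Metric.ball o (n : ℝ) ∩ P).encard : ENat) : ENNReal) / ((n : ℝ) : EReal)) atTop

/-- `S` is separated: for some `ε > 0`, distinct points of `S` are at distance `> ε`. -/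
def IsSeparatedSet {X : Type*} [MetricSpace X] (S : Set X) : Prop :=
  ∃ ε : ℝ, 0 < ε ∧ ∀ x ∈ S, ∀ y ∈ S, x ≠ y → ε < dist x y

open Classical in
/-- The entropy of a subset `P` of `X`: the supremum of the critical exponents of `P ∩ S` over
the separated subsets `S` of `X`, with the convention that the empty set has entropy `0`. -/
noncomputable def entropy {X : Type*} [MetricSpace X] (o : X) (P : Set X) : EReal :=
  if P = ∅ then 0 else ⨆ (S : Set X) (_ : IsSeparatedSet S), criticalExponent o (P ∩ S)

/-! ### Semigroups of isometries -/

/-- The orbit `A o` of the base point under a set `A` of isometries. -/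
def orbit {X : Type*} [MetricSpace X] (o : X) (A : Set (X ≃ᵢ X)) : Set X :=
  (fun γ : X ≃ᵢ X => γ o) '' A

/-- The limit set of a semigroup of isometries: the boundary of the orbit of `o`. -/
def limitSet {X : Type*} [MetricSpace X] (o : X) (Γ : Subsemigroup (X ≃ᵢ X)) :
    Set (GromovBoundary o) :=
  boundaryOf o (orbit o Γ)

/-- `A` and `B` are Gromov-disjoint: their closures in `X` are disjoint, and `(a|b)` is bounded
above on `A × B`. -/
def GromovDisjoint {X : Type*} [MetricSpace X] (o : X) (A B : Set X) : Prop :=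
  Disjoint (closure A) (closure B) ∧
    ∃ C : ℝ, 0 < C ∧ ∀ a ∈ A, ∀ b ∈ B, gromovProduct o a b < C

/-- `Γ` is a Schottky semigroup for the subset `Y` of `X`: it is generated, as a semigroup, by a
nonempty finite set `G` such that the sets `g Y` (`g ∈ G`) and `X \ Y` are pairwise
Gromov-disjoint and `Y \ ⋃_{g ∈ G} g Y` has nonempty interior. -/
def IsSchottkyFor {X : Type*} [MetricSpace X] (o : X) (Γ : Subsemigroup (X ≃ᵢ X))
    (Y : Set X) : Prop :=
  ∃ G : Set (X ≃ᵢ X), G.Finite ∧ G.Nonempty ∧ Subsemigroup.closure G = Γ ∧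
    (∀ g ∈ G, ∀ g' ∈ G, g ≠ g' → GromovDisjoint o (g '' Y) (g' '' Y)) ∧
    (∀ g ∈ G, GromovDisjoint o (g '' Y) Yᶜ) ∧
    (interior (Y \ ⋃ g ∈ G, g '' Y)).Nonempty

/-- `Γ` is a Schottky semigroup of isometries of `X`. -/
def IsSchottky {X : Type*} [MetricSpace X] (o : X) (Γ : Subsemigroup (X ≃ᵢ X)) : Prop :=
  ∃ Y : Set X, IsSchottkyFor o Γ Y

end GromovHyp

open Filter Topology

namespace GromovHyp

/-! Compactness of `X ∪ ∂X` enters in two ways: `X` is proper, and outside a bounded set it is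
covered by finitely many sets with large mutual Gromov products (`exists_finite_cover`).

Upper bound: a Schottky semigroup acts freely with a uniformly separated orbit at an interior point
of the ping-pong domain minus its pieces. Thinning `Γ' o` to a 1-separated set therefore costs only
a bounded factor, which the exponent does not see.

Lower bound: for `0 ≤ h` below the entropy, `Γ` is `IsRich`, meaning that it has growth rate above
`h` at every scale of separation. Richness survives finite partitions, left translation and linear
losses, so there are rich `B ⊆ Γ` for which all `γ o`, and likewise all `γ⁻¹ o`, point in nearly one
direction. If these two directions differ, a separated family in a thin annulus of `B` plays
ping-pong (`exists_pingPong_domain`) and freely generates a Schottky semigroup of growth at least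
`h`.

Otherwise the two directions agree for every rich concentrated subset. Along nested such sets `γ n
o` converges to a boundary point `p`, and applying the same to the translates by `α ∈ Γ` shows that
`α` fixes `p`. As the limit set has a second point, some `α` moves `o` far in a direction other than
`p`; it brings points near `p` closer to `o`. Pushing by powers of `α` makes `Γ` rich away from `p`
(`of_contraction`). A concentrated rich part there contains a `β` with `β o` and `β⁻¹ o` close
together and both away from `p`; then `β` sends `p` close to `β o`, so it cannot fix `p`.

Negative `h` need only one Schottky semigroup, generated by a single element. -/

variable {X : Type*} [MetricSpace X]

/-! ### Gromov products and isometries -/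

/-- `X` is Gromov-hyperbolic with constant `δ`. -/
def IsHyperbolicWith (o : X) (δ : ℝ) : Prop :=
  0 ≤ δ ∧ ∀ x y z : X,
    min (gromovProduct o x y) (gromovProduct o y z) - δ ≤ gromovProduct o x z

theorem IsHyperbolicWith.le {o : X} {δ : ℝ} (h : IsHyperbolicWith o δ) {x z : X} (y : X) {t : ℝ}
    (h₁ : t ≤ gromovProduct o x y) (h₂ : t ≤ gromovProduct o y z) :
    t - δ ≤ gromovProduct o x z := by
  have := h.2 x y z
  have := le_min h₁ h₂
  linarith

theorem gromovProduct_nonneg (o x y : X) : 0 ≤ gromovProduct o x y := by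
  unfold gromovProduct
  have := dist_triangle_right x y o
  linarith

theorem gromovProduct_le_left (o x y : X) : gromovProduct o x y ≤ dist x o := by
  unfold gromovProduct
  have := dist_triangle_left y o x
  rw [dist_comm x y] at *
  have := dist_triangle y x o
  linarith

theorem gromovProduct_self (o x : X) : gromovProduct o x x = dist x o := by
  unfold gromovProduct
  rw [dist_self]
  ring

theorem gromovProduct_le_add_dist_left (o x x' y : X) :
    gromovProduct o x y ≤ gromovProduct o x' y + dist x x' := by
  unfold gromovProduct
  have := dist_triangle x x' o
  have := dist_triangle_left x' y x
  linarith

theorem gromovProduct_le_add_dist_right (o x y y' : X) :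
    gromovProduct o x y ≤ gromovProduct o x y' + dist y y' := by
  rw [gromovProduct_comm o x y, gromovProduct_comm o x y']
  exact gromovProduct_le_add_dist_left o y y' x

theorem dist_eq_sub_gromovProduct (o x y : X) :
    dist x y = dist x o + dist y o - 2 * gromovProduct o x y := by
  unfold gromovProduct
  ring

theorem dist_inv_apply (γ : X ≃ᵢ X) (x y : X) : dist (γ⁻¹ x) y = dist x (γ y) := by
  rw [← γ.dist_eq, IsometryEquiv.apply_inv_self]

theorem dist_inv_apply_base (γ : X ≃ᵢ X) (o : X) : dist (γ⁻¹ o) o = dist (γ o) o := by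
  rw [dist_inv_apply, dist_comm]

/-- The source of all contraction below: if `x` does not point towards `γ⁻¹ o`, then `γ x` lies deep
in the shadow of `γ o`, and conversely. -/
theorem gromovProduct_map_add (o : X) (γ : X ≃ᵢ X) (x : X) :
    gromovProduct o (γ x) (γ o) + gromovProduct o x (γ⁻¹ o) = dist (γ o) o := by
  unfold gromovProduct
  rw [γ.dist_eq, dist_inv_apply_base, dist_comm x (γ⁻¹ o), dist_inv_apply, dist_comm o (γ x)]
  ring

theorem gromovProduct_le_map (o : X) (γ : X ≃ᵢ X) (x y : X) :
    gromovProduct o x y ≤ gromovProduct o (γ x) (γ y) + dist (γ o) o := by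
  unfold gromovProduct
  rw [γ.dist_eq]
  have h₁ := dist_triangle_right (γ x) (γ o) o
  have h₂ := dist_triangle_right (γ y) (γ o) o
  have h₃ := dist_triangle_right (γ x) o (γ o)
  have h₄ := dist_triangle (γ x) o (γ o)
  have h₅ := dist_triangle (γ y) o (γ o)
  rw [γ.dist_eq, dist_comm o (γ o)] at *
  linarith

/-- A finite family in a ball, separated by `ε`, has boundedly many members. -/
theorem exists_card_le_of_separated [ProperSpace X] (x : X) (ρ : ℝ) {ε : ℝ} (hε : 0 < ε) :
    ∃ M : ℕ, 0 < M ∧ ∀ {ι : Type*} (F : Finset ι) (f : ι → X),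
      (∀ i ∈ F, f i ∈ Metric.closedBall x ρ) →
      (∀ i ∈ F, ∀ j ∈ F, i ≠ j → ε ≤ dist (f i) (f j)) → F.card ≤ M := by
  classical
  obtain ⟨t, -, ht, hcov⟩ := totallyBounded_iff_subset.1
    (isCompact_closedBall x ρ).totallyBounded _ (Metric.dist_mem_uniformity (half_pos hε))
  refine ⟨ht.toFinset.card + 1, Nat.succ_pos _, fun {ι} F f hf hsep => ?_⟩
  have hex : ∀ i ∈ F, ∃ c ∈ ht.toFinset, dist (f i) c < ε / 2 := by
    intro i hi
    have := hcov (hf i hi)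
    simp only [Set.mem_iUnion, Set.mem_ofPred_eq] at this
    obtain ⟨c, hc, h⟩ := this
    exact ⟨c, ht.mem_toFinset.2 hc, h⟩
  have : Nonempty X := ⟨x⟩
  choose! c hc hdist using hex
  refine (Finset.card_le_card_of_injOn c hc ?_).trans (Nat.le_succ _)
  intro i hi j hj hij
  by_contra hne
  have h₁ := hsep i hi j hj hne
  have h₂ := hdist i hi
  have h₃ := hdist j hj
  rw [← hij] at h₃
  have := dist_triangle_right (f i) (f j) (c i)
  linarith

/-! ### The Gromov closure: properness and finite covers -/

theorem exists_seq_of_lt_extendedProduct {o x : X} {ξ : GromovBoundary o} {t : ℝ}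
    (h : (t : EReal) < extendedProduct (.pt x) (.bdry ξ)) :
    ∃ v : ConvergentSeq o, Quot.mk (SeqEquiv o) v = ξ ∧
      ∀ᶠ j in atTop, t - 1 < gromovProduct o x (v.1 j) := by
  unfold extendedProduct at h
  simp only [lt_iSup_iff] at h
  obtain ⟨u, v, hu, ⟨w, rfl, hw⟩, h⟩ := h
  refine ⟨w, hw, ?_⟩
  have h₁ : ∀ᶠ p : ℕ × ℕ in atTop ×ˢ atTop,
      (t : EReal) < (gromovProduct o (u p.1) (w.1 p.2) : ℝ) := by
    rw [prod_atTop_atTop_eq]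
    exact eventually_lt_of_lt_liminf h
  have h₂ : ∀ᶠ i in atTop, dist (u i) x < 1 := Metric.tendsto_nhds.1 hu 1 one_pos
  obtain ⟨i, hi₁, hi₂⟩ := (h₁.curry.and h₂).exists
  filter_upwards [hi₁] with j hj
  have h₃ : t < gromovProduct o (u i) (w.1 j) := by exact_mod_cast hj
  have := gromovProduct_le_add_dist_left o (u i) x (w.1 j)
  linarith

theorem extendedProduct_pt_le {o x : X} {ξ : GromovBoundary o} {t : ℝ}
    (h : (t : EReal) < extendedProduct (.pt x) (.bdry ξ)) : t - 1 < dist x o := by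
  obtain ⟨v, -, hv⟩ := exists_seq_of_lt_extendedProduct h
  obtain ⟨j, hj⟩ := hv.exists
  exact hj.trans_le (gromovProduct_le_left _ _ _)

/-- The loss is 1 for replacing sequences tending to `x` and `y` by these points, and `2 * δ` for
passing from `x` to `y` through two sequences representing `ξ`. -/
theorem IsHyperbolicWith.le_of_lt_extendedProduct {o x y : X} {δ : ℝ}
    (hX : IsHyperbolicWith o δ) {ξ : GromovBoundary o} {t : ℝ}
    (hx : (t : EReal) < extendedProduct (.pt x) (.bdry ξ))
    (hy : (t : EReal) < extendedProduct (.pt y) (.bdry ξ)) :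
    t - 1 - 2 * δ ≤ gromovProduct o x y := by
  obtain ⟨v, hv, hxv⟩ := exists_seq_of_lt_extendedProduct hx
  obtain ⟨w, hw, hyw⟩ := exists_seq_of_lt_extendedProduct hy
  have hvw : SeqEquiv o v w :=
    (gromovBoundary_mk_eq_iff ⟨δ, hX⟩ v w).1 (hv.trans hw.symm)
  have h₁ : ∀ᶠ p : ℕ × ℕ in atTop ×ˢ atTop,
      t - 1 ≤ gromovProduct o (v.1 p.1) (w.1 p.2) := by
    rw [prod_atTop_atTop_eq]
    exact hvw.eventually_ge_atTop (t - 1)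
  obtain ⟨i, hi₁, hi₂⟩ := (h₁.curry.and hxv).exists
  obtain ⟨j, hj₁, hj₂⟩ := (hi₁.and hyw).exists
  rw [gromovProduct_comm] at hj₂
  have h₂ := hX.le _ hi₂.le hj₁
  have h₃ := hX.le (t := t - 1 - δ) _ h₂ (by linarith [hX.1])
  linarith

theorem boundaryBall_exp {o : X} (ξ : GromovBoundary o) (t : ℝ) (z : GromovClosure o) :
    z ∈ boundaryBall ξ (Real.exp (-t)) ↔ (t : EReal) < extendedProduct z (.bdry ξ) := by
  simp [boundaryBall]

theorem isInducing_pt (o : X) :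
    IsInducing (GromovClosure.pt : X → GromovClosure o) := by
  refine ⟨?_⟩
  ext s
  rw [isOpen_induced_iff]
  constructor
  · intro hs
    refine ⟨GromovClosure.pt '' s, ⟨?_, ?_⟩, ?_⟩
    · rintro x ⟨y, hy, hyx⟩
      cases hyx
      obtain ⟨r, hr, h⟩ := Metric.isOpen_iff.1 hs x hy
      exact ⟨r, hr, Set.image_mono h⟩
    · rintro ξ ⟨y, -, hy⟩
      cases hy
    · exact Set.preimage_image_eq _ fun x y h => by cases h; rfl
  · rintro ⟨t, ht, rfl⟩
    refine Metric.isOpen_iff.2 fun x hx => ?_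
    obtain ⟨r, hr, h⟩ := ht.1 x hx
    exact ⟨r, hr, fun y hy => h ⟨y, hy, rfl⟩⟩

/-- A closed subset of `X` is closed in `X ∪ ∂X` if every boundary point has a neighbourhood
that misses it. -/
theorem isClosed_image_pt {o : X} {s : Set X} (hs : IsClosed s)
    (h : ∀ ξ : GromovBoundary o, ∃ t : ℝ, ∀ x ∈ s,
      ¬ (t : EReal) < extendedProduct (.pt x) (.bdry ξ)) :
    IsClosed (GromovClosure.pt '' s : Set (GromovClosure o)) := by
  rw [← isOpen_compl_iff]
  constructor
  · intro x hx
    have hxs : x ∈ sᶜ := fun h => hx ⟨x, h, rfl⟩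
    obtain ⟨r, hr, hr'⟩ := Metric.isOpen_iff.1 hs.isOpen_compl x hxs
    refine ⟨r, hr, ?_⟩
    rintro _ ⟨y, hy, rfl⟩ ⟨z, hz, hzy⟩
    cases hzy
    exact hr' hy hz
  · intro ξ _
    obtain ⟨t, ht⟩ := h ξ
    refine ⟨Real.exp (-t), Real.exp_pos _, ?_⟩
    rintro _ hz ⟨x, hx, rfl⟩
    exact ht x hx ((boundaryBall_exp ξ t _).1 hz)

/-- A small neighbourhood of a boundary point contains only points of `X` far from `o`, so closed
balls about `o` stay closed in the compact space `X ∪ ∂X`. -/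
theorem properSpace_of_compactSpace_gromovClosure (o : X) [CompactSpace (GromovClosure o)] :
    ProperSpace X := by
  have hc : ∀ r : ℝ, IsCompact (Metric.closedBall o r) := by
    intro r
    rw [(isInducing_pt o).isCompact_iff]
    refine (isClosed_image_pt Metric.isClosed_closedBall fun ξ => ⟨r + 1, fun x hx h => ?_⟩).isCompact
    have := extendedProduct_pt_le h
    have := Metric.mem_closedBall.1 hx
    linarith
  exact ProperSpace.of_isCompact_closedBall_of_le 0 fun x r _ =>
    (hc (r + dist x o)).of_isClosed_subset Metric.isClosed_closedBall
      (Metric.closedBall_subset_closedBall' le_rfl)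

/-- If `X ∪ ∂X` is compact, then outside a bounded set `X` is covered by finitely many sets
with large Gromov products. -/
theorem IsHyperbolicWith.exists_finite_cover {o : X} {δ : ℝ} (hX : IsHyperbolicWith o δ)
    [CompactSpace (GromovClosure o)] (R : ℝ) :
    ∃ 𝒰 : Set (Set X), 𝒰.Finite ∧ (∀ x, ∃ U ∈ 𝒰, x ∈ U) ∧
      ∀ U ∈ 𝒰, (∃ ρ, U ⊆ Metric.closedBall o ρ) ∨ ∀ x ∈ U, ∀ y ∈ U, R ≤ gromovProduct o x y := by
  by_contra hno
  push Not at hno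
  -- Without a finite cover, points escaping to infinity with pairwise bounded Gromov products can
  -- be chosen greedily; compactness will forbid this.
  have key : ∀ s : Finset X, ∃ y, ∀ x ∈ s,
      gromovProduct o x y < R + δ ∧ dist x o + 1 ≤ dist y o := by
    intro s
    by_contra hs
    push Not at hs
    obtain ⟨U, hU, hU₁, x, hx, y, hy, hxy⟩ := hno
      (((fun a => {y | R + δ ≤ gromovProduct o a y}) '' (s : Set X)) ∪
        ((fun a => Metric.closedBall o (dist a o + 1)) '' (s : Set X)))
      ((s.finite_toSet.image _).union (s.finite_toSet.image _)) (by
        intro y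
        obtain ⟨a, ha, h⟩ := hs y
        by_cases h' : gromovProduct o a y < R + δ
        · exact ⟨_, Or.inr ⟨a, ha, rfl⟩, (h h').le⟩
        · exact ⟨_, Or.inl ⟨a, ha, rfl⟩, not_lt.1 h'⟩)
    rcases hU with ⟨a, -, rfl⟩ | ⟨a, -, rfl⟩
    · simp only [Set.mem_ofPred_eq] at hx hy
      rw [gromovProduct_comm] at hx
      have := hX.le _ hx hy
      linarith
    · exact hU₁ _ le_rfl
  obtain ⟨x, -, hx⟩ := exists_seq_of_forall_finset_exists (fun _ : X => True)
    (fun x y => gromovProduct o x y < R + δ ∧ dist x o + 1 ≤ dist y o)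
    (fun s _ => by simpa using key s)
  have hlarge : ∀ n : ℕ, (n : ℝ) ≤ dist (x n) o := by
    intro n
    induction n with
    | zero => simp
    | succ n ih =>
      have := (hx n (n + 1) n.lt_succ_self).2
      push_cast
      linarith
  have hclosed : ∀ n, IsClosed (GromovClosure.pt '' (x '' Set.Ici n) : Set (GromovClosure o)) := by
    intro n
    refine isClosed_image_pt ?_ ?_
    · have hlf : LocallyFinite fun i : Set.Ici n => ({x i} : Set X) := by
        intro y
        refine ⟨Metric.ball y 1, Metric.ball_mem_nhds y one_pos, ?_⟩
        refine Set.Finite.of_injOn (f := Subtype.val) (t := Set.Iic ⌈dist y o + 1⌉₊) ?_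
          Subtype.val_injective.injOn (Set.finite_Iic _)
        rintro i ⟨z, hz, hzb⟩
        rw [Set.mem_singleton_iff.1 hz, Metric.mem_ball] at hzb
        have h₁ := hlarge i
        have h₂ := dist_triangle (x i) y o
        have h₃ := Nat.le_ceil (dist y o + 1)
        have : ((i : ℕ) : ℝ) ≤ ⌈dist y o + 1⌉₊ := by linarith
        exact_mod_cast this
      have := hlf.isClosed_iUnion fun _ => isClosed_singleton
      rwa [show (⋃ i : Set.Ici n, ({x i} : Set X)) = x '' Set.Ici n by
        ext; simp [eq_comm]] at this
    · intro ξ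
      -- Two different `x i` this close to `ξ` would have Gromov product at least `R + δ`. So at
      -- most one is, and the second entry of the maximum below excludes that one too.
      by_cases h : ∃ i, ((R + δ + 1 + 2 * δ : ℝ) : EReal) <
          extendedProduct (.pt (x i)) (.bdry ξ)
      · obtain ⟨i, hi⟩ := h
        refine ⟨max (R + δ + 1 + 2 * δ) (dist (x i) o + 1), ?_⟩
        rintro _ ⟨j, -, rfl⟩ hj
        have hj' := (EReal.coe_le_coe_iff.2 (le_max_left _ _)).trans_lt hj
        rcases lt_trichotomy i j with hij | rfl | hij
        · have h₁ := (hx i j hij).1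
          have h₂ := hX.le_of_lt_extendedProduct hi hj'
          linarith
        · have h₁ := extendedProduct_pt_le hj
          have := le_max_right (R + δ + 1 + 2 * δ) (dist (x i) o + 1)
          linarith
        · have h₁ := (hx j i hij).1
          have h₂ := hX.le_of_lt_extendedProduct hj' hi
          linarith
      · push Not at h
        refine ⟨R + δ + 1 + 2 * δ, ?_⟩
        rintro _ ⟨j, -, rfl⟩
        exact not_lt.2 (h j)
  -- The tails are nested, compact and nonempty, yet no point belongs to all of them since `dist (x
  -- n) o` tends to infinity.
  obtain ⟨z, hz⟩ := IsCompact.nonempty_iInter_of_sequence_nonempty_isCompact_isClosed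
    (fun n => (GromovClosure.pt '' (x '' Set.Ici n) : Set (GromovClosure o)))
    (fun n => Set.image_mono (Set.image_mono (Set.Ici_subset_Ici.2 n.le_succ)))
    (fun n => ⟨_, _, ⟨n, Set.self_mem_Ici, rfl⟩, rfl⟩) (hclosed 0).isCompact hclosed
  rw [Set.mem_iInter] at hz
  obtain ⟨y, -, rfl⟩ := hz 0
  obtain ⟨_, ⟨i, hi, rfl⟩, h⟩ := hz (⌈dist y o⌉₊ + 1)
  cases h
  have h₁ := Nat.le_ceil (dist (x i) o)
  have h₂ := hlarge i
  have h₃ : (((⌈dist (x i) o⌉₊ + 1 : ℕ)) : ℝ) ≤ i := by exact_mod_cast hi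
  push_cast at h₃
  linarith

/-! ### Counting and critical exponents -/

theorem coe_le_log_div_iff {a : ENNReal} {c : ℝ} {n : ℕ} (hn : 0 < n) :
    (c : EReal) ≤ ENNReal.log a / ((n : ℝ) : EReal) ↔ ENNReal.ofReal (Real.exp (c * n)) ≤ a := by
  have hn' : (0 : EReal) < ((n : ℝ) : EReal) := by exact_mod_cast hn
  rw [EReal.le_div_iff_mul_le hn' (EReal.coe_ne_top _), ← EReal.coe_mul,
    ← ENNReal.log_strictMono.le_iff_le, ENNReal.log_ofReal_of_pos (Real.exp_pos _), Real.log_exp]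

/-- The number of points of `P` in the ball of radius `r` about `o`. -/
noncomputable def ballCount (o : X) (P : Set X) (r : ℝ) : ENNReal :=
  (((Metric.ball o r ∩ P).encard : ENat) : ENNReal)

theorem le_criticalExponent {o : X} {P : Set X} {c : ℝ}
    (h : ∃ᶠ n : ℕ in atTop, ENNReal.ofReal (Real.exp (c * n)) ≤ ballCount o P n) :
    (c : EReal) ≤ criticalExponent o P :=
  le_limsup_of_frequently_le' ((h.and_eventually (eventually_gt_atTop 0)).mono fun _ hn =>
    (coe_le_log_div_iff hn.2).2 hn.1)

theorem frequently_of_lt_criticalExponent {o : X} {P : Set X} {c : ℝ}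
    (h : (c : EReal) < criticalExponent o P) :
    ∃ᶠ n : ℕ in atTop, ENNReal.ofReal (Real.exp (c * n)) ≤ ballCount o P n :=
  ((frequently_lt_of_lt_limsup (by isBoundedDefault) h).and_eventually
    (eventually_gt_atTop 0)).mono fun _ hn => (coe_le_log_div_iff hn.2).1 hn.1.le

/-- Exponential growth absorbs linear factors and shifts. -/
theorem eventually_exp_le {c c' : ℝ} (h : c < c') (C : ℝ) (a : ℕ) :
    ∀ᶠ n : ℕ in atTop, C * (n + 1) * Real.exp (c * (n + a : ℕ)) ≤ Real.exp (c' * n) := by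
  have h₁ : Tendsto (fun n : ℕ => Real.exp ((c' - c) * n) / (n : ℝ) ^ 1) atTop atTop :=
    (tendsto_exp_mul_div_rpow_atTop 1 (c' - c) (sub_pos.2 h)).comp tendsto_natCast_atTop_atTop
      |>.congr fun n => by simp
  filter_upwards [h₁.eventually_ge_atTop (|C| * 2 * Real.exp (c * a)), eventually_ge_atTop 1]
    with n hn hn1
  have hn1' : (1 : ℝ) ≤ n := by exact_mod_cast hn1
  rw [pow_one, le_div_iff₀ (by linarith)] at hn
  have e : Real.exp (c' * n) = Real.exp ((c' - c) * n) * Real.exp (c * n) := by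
    rw [← Real.exp_add]; ring_nf
  have e' : Real.exp (c * (n + a : ℕ)) = Real.exp (c * a) * Real.exp (c * n) := by
    rw [← Real.exp_add]; push_cast; ring_nf
  rw [e, e', ← mul_assoc]
  refine mul_le_mul_of_nonneg_right (le_trans ?_ hn) (Real.exp_pos _).le
  have : C * (n + 1) ≤ |C| * 2 * n :=
    calc C * (n + 1) ≤ |C| * (n + 1) :=
          mul_le_mul_of_nonneg_right (le_abs_self C) (by positivity)
      _ ≤ |C| * (2 * n) := mul_le_mul_of_nonneg_left (by linarith) (abs_nonneg C)
      _ = _ := by ring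
  calc C * (n + 1) * Real.exp (c * a) ≤ |C| * 2 * n * Real.exp (c * a) :=
        mul_le_mul_of_nonneg_right this (Real.exp_pos _).le
    _ = _ := by ring

theorem criticalExponent_le_of_ballCount_le {o : X} {P Q : Set X} {M : ℕ} (hM : 0 < M)
    (h : ∀ n : ℕ, ballCount o P n ≤ M * ballCount o Q (n + 1 : ℕ)) :
    criticalExponent o P ≤ criticalExponent o Q := by
  by_contra hlt
  obtain ⟨c, hc₁, hc₂⟩ := EReal.lt_iff_exists_real_btwn.1 (not_le.1 hlt)
  obtain ⟨c', hc', hc₃⟩ := EReal.lt_iff_exists_real_btwn.1 hc₂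
  have hfreq := (frequently_of_lt_criticalExponent hc₃).and_eventually
    (eventually_exp_le (EReal.coe_lt_coe_iff.1 hc') M 1)
  refine absurd (le_criticalExponent (o := o) (P := Q) (c := c) ?_) (not_le.2 hc₁)
  refine (tendsto_add_atTop_nat 1).frequently (hfreq.mono fun n ⟨h₁, h₂⟩ => ?_)
  have h₃ : (M : ℝ) * Real.exp (c * (n + 1 : ℕ)) ≤ Real.exp (c' * n) := by
    refine le_trans (mul_le_mul_of_nonneg_right ?_ (Real.exp_pos _).le) h₂
    exact le_mul_of_one_le_right (Nat.cast_nonneg _) (by simp)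
  have h₄ := (ENNReal.ofReal_le_ofReal h₃).trans (h₁.trans (h n))
  rw [ENNReal.ofReal_mul (Nat.cast_nonneg _), ENNReal.ofReal_natCast] at h₄
  exact (ENNReal.mul_le_mul_iff_right (by simpa using hM.ne') (ENNReal.natCast_ne_top _)).1 h₄

theorem criticalExponent_nonneg {o : X} {P : Set X} (hP : P.Nonempty) :
    0 ≤ criticalExponent o P := by
  obtain ⟨x, hx⟩ := hP
  refine le_criticalExponent (c := 0) (Eventually.frequently ?_)
  filter_upwards [eventually_gt_atTop ⌈dist x o⌉₊] with n hn
  have hn' : dist x o < n := (Nat.le_ceil _).trans_lt (by exact_mod_cast hn)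
  have : 1 ≤ (Metric.ball o (n : ℝ) ∩ P).encard :=
    Set.one_le_encard_iff_nonempty.2 ⟨x, hn', hx⟩
  simpa [ballCount] using ENat.toENNReal_le.2 this

/-- Every family of points contains a maximal `L`-separated subfamily. -/
theorem exists_maximal_separated {ι : Type*} (f : ι → X) (A : Set ι) {L : ℝ} (hL : 0 < L) :
    ∃ S ⊆ A, (∀ i ∈ S, ∀ j ∈ S, i ≠ j → L ≤ dist (f i) (f j)) ∧
      ∀ i ∈ A, ∃ j ∈ S, dist (f i) (f j) < L := by
  obtain ⟨S, hS⟩ := zorn_subset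
    {S | S ⊆ A ∧ ∀ i ∈ S, ∀ j ∈ S, i ≠ j → L ≤ dist (f i) (f j)} (by
      intro c hc hchain
      refine ⟨⋃₀ c, ⟨Set.sUnion_subset fun s hs => (hc hs).1, ?_⟩,
        fun s hs => Set.subset_sUnion_of_mem hs⟩
      rintro i ⟨s, hs, hi⟩ j ⟨t, ht, hj⟩ hij
      rcases hchain.total hs ht with h | h
      · exact (hc ht).2 i (h hi) j hj hij
      · exact (hc hs).2 i hi j (h hj) hij)
  refine ⟨S, hS.prop.1, hS.prop.2, fun i hi => ?_⟩
  by_contra hno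
  push Not at hno
  have hmem : insert i S ∈ {S | S ⊆ A ∧ ∀ i ∈ S, ∀ j ∈ S, i ≠ j → L ≤ dist (f i) (f j)} := by
    refine ⟨Set.insert_subset hi hS.prop.1, ?_⟩
    rintro a (rfl | ha) b (rfl | hb) hab
    · exact absurd rfl hab
    · exact hno b hb
    · rw [dist_comm]
      exact hno a ha
    · exact hS.prop.2 a ha b hb hab
  have := hno i (hS.le_of_ge hmem (Set.subset_insert _ _) (Set.mem_insert _ _))
  rw [dist_self] at this
  linarith

theorem encard_le_of_forall_finset {α : Type*} {s : Set α} {M : ℕ}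
    (h : ∀ F : Finset α, (F : Set α) ⊆ s → F.card ≤ M) : s.encard ≤ M := by
  by_contra hlt
  have h₁ : ((M + 1 : ℕ) : ℕ∞) ≤ s.encard := by
    push_cast
    exact Order.add_one_le_of_lt (not_le.1 hlt)
  obtain ⟨t, hts, ht⟩ := Set.exists_subset_encard_eq h₁
  have hfin : t.Finite := Set.finite_of_encard_eq_coe ht
  have h₂ := h hfin.toFinset (by simpa using hts)
  rw [hfin.encard_eq_coe_toFinset_card] at ht
  have : hfin.toFinset.card = M + 1 := by exact_mod_cast ht
  omega

/-! ### Ping-pong words and the upper bound by the entropy -/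

theorem exists_list_prod_eq {M : Type*} [Monoid M] {G : Set M} {a : M}
    (ha : a ∈ Subsemigroup.closure G) : ∃ l : List M, (∀ g ∈ l, g ∈ G) ∧ l.prod = a := by
  induction ha using Subsemigroup.closure_induction with
  | mem x hx => exact ⟨[x], by simpa using hx, by simp⟩
  | mul x y _ _ hx hy =>
    obtain ⟨l, hl, rfl⟩ := hx
    obtain ⟨l', hl', rfl⟩ := hy
    refine ⟨l ++ l', fun g hg => ?_, by simp⟩
    rcases List.mem_append.1 hg with h | h
    exacts [hl g h, hl' g h]

/-- Ping-pong: different words move the complement of the pieces to disjoint sets. -/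
theorem list_eq_of_prod_apply_eq {G : Set (X ≃ᵢ X)} {Y : Set X}
    (hdisj : ∀ g ∈ G, ∀ g' ∈ G, g ≠ g' → Disjoint (g '' Y) (g' '' Y))
    (hsub : ∀ g ∈ G, g '' Y ⊆ Y) {x y : X} (hx : x ∈ Y \ ⋃ g ∈ G, g '' Y)
    (hy : y ∈ Y \ ⋃ g ∈ G, g '' Y) :
    ∀ l l' : List (X ≃ᵢ X), (∀ g ∈ l, g ∈ G) → (∀ g ∈ l', g ∈ G) →
      l.prod x = l'.prod y → l = l' := by
  have hmem : ∀ z ∈ Y, ∀ l : List (X ≃ᵢ X), (∀ g ∈ l, g ∈ G) → l.prod z ∈ Y := by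
    intro z hz l hl
    induction l with
    | nil => simpa using hz
    | cons g t ih =>
      rw [List.prod_cons, IsometryEquiv.mul_apply]
      exact hsub g (hl g (by simp)) ⟨_, ih fun a ha => hl a (by simp [ha]), rfl⟩
  intro l
  induction l with
  | nil =>
    rintro (_ | ⟨g, t⟩) - hl' h
    · rfl
    · rw [List.prod_cons, IsometryEquiv.mul_apply] at h
      exact (hx.2 (Set.mem_biUnion (hl' g (by simp))
        ⟨_, hmem y hy.1 t fun a ha => hl' a (by simp [ha]), h.symm⟩)).elim
  | cons g t ih =>
    rintro (_ | ⟨g', t'⟩) hl hl' h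
    · rw [List.prod_cons, IsometryEquiv.mul_apply] at h
      exact (hy.2 (Set.mem_biUnion (hl g (by simp))
        ⟨_, hmem x hx.1 t fun a ha => hl a (by simp [ha]), h⟩)).elim
    · rw [List.prod_cons, IsometryEquiv.mul_apply, List.prod_cons, IsometryEquiv.mul_apply] at h
      have ht : ∀ a ∈ t, a ∈ G := fun a ha => hl a (by simp [ha])
      have ht' : ∀ a ∈ t', a ∈ G := fun a ha => hl' a (by simp [ha])
      by_cases hg : g = g'
      · subst hg
        rw [ih t' ht ht' (g.injective h)]
      · refine absurd ?_ (Set.disjoint_left.1 (hdisj g (hl g (by simp)) g' (hl' g' (by simp)) hg)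
          ⟨_, hmem x hx.1 t ht, rfl⟩)
        exact ⟨_, hmem y hy.1 t' ht', h.symm⟩

/-- Some point of `X` has a uniformly separated orbit under a Schottky semigroup, on which the
semigroup acts freely. -/
theorem IsSchottky.exists_separated_orbit {o : X} {Γ : Subsemigroup (X ≃ᵢ X)}
    (h : IsSchottky o Γ) : ∃ (x : X) (ε : ℝ), 0 < ε ∧
      ∀ γ ∈ Γ, ∀ γ' ∈ Γ, γ ≠ γ' → ε ≤ dist (γ x) (γ' x) := by
  obtain ⟨Y, G, -, -, rfl, hdisj, hsub, x, hx⟩ := h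
  obtain ⟨ε, hε, hball⟩ := Metric.mem_nhds_iff.1 (mem_interior_iff_mem_nhds.1 hx)
  refine ⟨x, ε, hε, fun γ hγ γ' hγ' hne => ?_⟩
  by_contra hlt
  obtain ⟨l, hl, rfl⟩ := exists_list_prod_eq hγ
  obtain ⟨l', hl', rfl⟩ := exists_list_prod_eq hγ'
  have hy : l.prod⁻¹ (l'.prod x) ∈ Metric.ball x ε := by
    rw [Metric.mem_ball, dist_inv_apply, dist_comm]
    exact not_le.1 hlt
  refine hne (congrArg List.prod (list_eq_of_prod_apply_eq
    (fun g hg g' hg' hgg' => (hdisj g hg g' hg' hgg').1.mono subset_closure subset_closure)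
    (fun g hg => ?_) (hball hy) (hball (Metric.mem_ball_self hε)) l l' hl hl' ?_))
  · exact Set.disjoint_compl_right_iff_subset.1
      ((hsub g hg).1.mono subset_closure subset_closure)
  · rw [IsometryEquiv.apply_inv_self]

theorem IsSchottky.criticalExponent_le_entropy [ProperSpace X] {o : X}
    {Γ Γ' : Subsemigroup (X ≃ᵢ X)} (h : IsSchottky o Γ') (hΓ : Γ' ≤ Γ) :
    criticalExponent o (orbit o Γ') ≤ entropy o (orbit o Γ) := by
  classical
  obtain ⟨x, ε, hε, hsep⟩ := h.exists_separated_orbit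
  have hne : orbit o Γ ≠ ∅ := by
    obtain ⟨Y, G, -, ⟨g, hg⟩, rfl, -⟩ := h
    exact Set.Nonempty.ne_empty ⟨g o, g, hΓ (Subsemigroup.subset_closure hg), rfl⟩
  obtain ⟨S, hSsub, hS, hcov⟩ := exists_maximal_separated id (orbit o (Γ' : Set _)) one_pos
  have hSΓ : orbit o (Γ : Set _) ∩ S = S :=
    Set.inter_eq_right.2 (hSsub.trans (Set.image_mono hΓ))
  have hSsep : IsSeparatedSet S :=
    ⟨1 / 2, by norm_num, fun a ha b hb hab =>
      lt_of_lt_of_le (by norm_num) (hS a ha b hb hab)⟩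
  rw [entropy, if_neg hne]
  refine le_trans ?_ (le_iSup₂_of_le S hSsep le_rfl)
  rw [hSΓ]
  -- Orbit points of `o` near `g o` give orbit points of `x` near `g x`; pulling back by `g⁻¹` puts
  -- them in one fixed ball about `x`, so `M` serves all centres.
  obtain ⟨M, hM, hpack⟩ := exists_card_le_of_separated x (2 * dist x o + 1) hε
  have hlocal : ∀ s ∈ S, (Metric.ball s 1 ∩ orbit o (Γ' : Set _)).encard ≤ M := by
    intro s hs
    obtain ⟨g, -, rfl⟩ := hSsub hs
    refine encard_le_of_forall_finset fun F hF => ?_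
    have hex : ∀ p ∈ F, ∃ γ ∈ Γ', γ o = p := fun p hp => (hF hp).2
    choose! γ hγ hγo using hex
    refine hpack F (fun p => g⁻¹ (γ p x)) (fun p hp => ?_) fun p hp q hq hpq => ?_
    · have h₁ : dist (γ p o) (g o) < 1 := by
        rw [hγo p hp]
        exact (hF hp).1
      rw [Metric.mem_closedBall, dist_inv_apply]
      have h₂ := dist_triangle4 (γ p x) (γ p o) (g o) (g x)
      rw [(γ p).dist_eq, g.dist_eq, dist_comm o x] at h₂
      linarith
    · rw [(g⁻¹).dist_eq]
      refine hsep _ (hγ p hp) _ (hγ q hq) fun heq => hpq ?_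
      rw [← hγo p hp, ← hγo q hq, heq]
  refine criticalExponent_le_of_ballCount_le hM fun n => ?_
  unfold ballCount
  by_cases hfin : (Metric.ball o ((n + 1 : ℕ) : ℝ) ∩ S).Finite
  · have h₁ : Metric.ball o (n : ℝ) ∩ orbit o (Γ' : Set _) ⊆
        ⋃ s ∈ hfin.toFinset, Metric.ball s 1 ∩ orbit o (Γ' : Set _) := by
      rintro p ⟨hpn, hp⟩
      obtain ⟨s, hs, hps⟩ := hcov p hp
      simp only [id_eq] at hps
      have h₂ := dist_triangle_left s o p
      have h₃ := Metric.mem_ball.1 hpn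
      refine Set.mem_biUnion (x := s) ?_ ⟨hps, hp⟩
      simp only [SetLike.mem_coe, Set.Finite.mem_toFinset]
      refine ⟨?_, hs⟩
      rw [Metric.mem_ball]
      push_cast
      linarith
    have h₂ := (Set.encard_le_encard h₁).trans (Finset.set_encard_biUnion_le _ _)
    have h₃ : ∑ s ∈ hfin.toFinset, (Metric.ball s 1 ∩ orbit o (Γ' : Set _)).encard ≤
        M * (Metric.ball o ((n + 1 : ℕ) : ℝ) ∩ S).encard := by
      refine (Finset.sum_le_card_nsmul _ _ (M : ℕ∞) fun s hs =>
        hlocal s (hfin.mem_toFinset.1 hs).2).trans ?_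
      rw [hfin.encard_eq_coe_toFinset_card, nsmul_eq_mul, mul_comm]
    have h₄ := ENat.toENNReal_le.2 (h₂.trans h₃)
    simpa using h₄
  · rw [Set.encard_eq_top hfin]
    simp [ENNReal.mul_top, hM.ne']

/-! ### Ping-pong domains and growth of free semigroups -/

/-- The orbit points `γ o` (`γ ∈ B`) have mutual Gromov products at least `R`, and so have the
points `γ⁻¹ o`. -/
def IsConcentrated (o : X) (R : ℝ) (B : Set (X ≃ᵢ X)) : Prop :=
  ∀ γ ∈ B, ∀ γ' ∈ B, R ≤ gromovProduct o (γ o) (γ' o) ∧ R ≤ gromovProduct o (γ⁻¹ o) (γ'⁻¹ o)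

theorem IsConcentrated.le_dist {o : X} {R : ℝ} {B : Set (X ≃ᵢ X)} (h : IsConcentrated o R B)
    {γ : X ≃ᵢ X} (hγ : γ ∈ B) : R ≤ dist (γ o) o := by
  rw [← gromovProduct_self]
  exact (h γ hγ γ hγ).1

theorem gromovDisjoint_of_lt {o : X} {A B : Set X} (C : ℝ)
    (h : ∀ a ∈ A, ∀ b ∈ B, gromovProduct o a b ≤ C ∧ 1 ≤ dist a b) : GromovDisjoint o A B := by
  refine ⟨Set.disjoint_left.2 fun z hz hz' => ?_, |C| + 1, by positivity, fun a ha b hb => ?_⟩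
  · obtain ⟨a, ha, hza⟩ := Metric.mem_closure_iff.1 hz (1 / 2) (by norm_num)
    obtain ⟨b, hb, hzb⟩ := Metric.mem_closure_iff.1 hz' (1 / 2) (by norm_num)
    have h₁ := (h a ha b hb).2
    have h₂ := dist_triangle_left a b z
    linarith
  · have h₁ := (h a ha b hb).1
    have h₂ := le_abs_self C
    linarith

/-- The points with small Gromov product with `γ₀⁻¹ o` form a ping-pong domain. -/
theorem IsHyperbolicWith.exists_pingPong_domain {o : X} {δ : ℝ} (hX : IsHyperbolicWith o δ)
    {R r : ℝ} {B G : Set (X ≃ᵢ X)} (hB : IsConcentrated o R B) (hG : G ⊆ B) {γ₀ : X ≃ᵢ X}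
    (hγ₀ : γ₀ ∈ B) (hR : 2 * gromovProduct o (γ₀ o) (γ₀⁻¹ o) + 6 * δ + 3 ≤ R)
    (hr : ∀ g ∈ G, r - 1 ≤ dist (g o) o ∧ dist (g o) o ≤ r)
    (hsep : ∀ g ∈ G, ∀ g' ∈ G, g ≠ g' →
      2 * gromovProduct o (γ₀ o) (γ₀⁻¹ o) + 10 * δ + 8 ≤ dist (g o) (g' o)) :
    ∃ Y : Set X, Metric.ball o 1 ⊆ Y \ ⋃ g ∈ G, g '' Y ∧
      (∀ g ∈ G, ∀ g' ∈ G, g ≠ g' → GromovDisjoint o (g '' Y) (g' '' Y)) ∧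
      ∀ g ∈ G, GromovDisjoint o (g '' Y) Yᶜ := by
  have hδ := hX.1
  have hK := gromovProduct_nonneg o (γ₀ o) (γ₀⁻¹ o)
  set K := gromovProduct o (γ₀ o) (γ₀⁻¹ o)
  set T := K + 2 * δ + 1 with hT
  set Y : Set X := {x | gromovProduct o x (γ₀⁻¹ o) ≤ T} with hY
  -- All `g⁻¹ o` point towards `γ₀⁻¹ o`, which `Y` avoids; so each `g '' Y` lies in the shadow of `g
  -- o`.
  have hshadow : ∀ g ∈ G, ∀ x ∈ Y, dist (g o) o - T - δ ≤ gromovProduct o (g x) (g o) := by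
    intro g hg x hx
    have h₁ : gromovProduct o x (g⁻¹ o) ≤ T + δ := by
      by_contra hlt
      have h₂ := (hB g (hG hg) γ₀ hγ₀).2
      have h₄ : min (gromovProduct o x (g⁻¹ o)) R - δ ≤ gromovProduct o x (γ₀⁻¹ o) :=
        hX.le _ (min_le_left _ _) ((min_le_right _ _).trans h₂)
      have h₅ : T + δ < min (gromovProduct o x (g⁻¹ o)) R :=
        lt_min (not_le.1 hlt) (by linarith)
      have h₆ : gromovProduct o x (γ₀⁻¹ o) ≤ T := hx
      linarith
    have := gromovProduct_map_add o g x
    linarith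
  have hfar : ∀ g ∈ G, ∀ x ∈ Y, R - T - 2 * δ ≤ gromovProduct o (g x) (γ₀ o) := by
    intro g hg x hx
    have h₁ := hshadow g hg x hx
    have h₂ := hB.le_dist (hG hg)
    have h₃ := (hB g (hG hg) γ₀ hγ₀).1
    have h₄ := hX.le (t := R - T - δ) _ (by linarith) (by linarith : _ ≤ gromovProduct o (g o) (γ₀ o))
    linarith
  refine ⟨Y, fun z hz => ⟨?_, ?_⟩, fun g hg g' hg' hne => ?_, fun g hg => ?_⟩
  · have h₁ := gromovProduct_le_left o z (γ₀⁻¹ o)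
    have h₂ := Metric.mem_ball.1 hz
    show gromovProduct o z (γ₀⁻¹ o) ≤ T
    linarith
  · simp only [Set.mem_iUnion, not_exists]
    rintro g hg ⟨x, hx, rfl⟩
    have h₁ := hfar g hg x hx
    have h₂ := gromovProduct_le_left o (g x) (γ₀ o)
    have h₃ := Metric.mem_ball.1 hz
    linarith
  · refine gromovDisjoint_of_lt (r - T - δ - 2) ?_
    rintro _ ⟨x, hx, rfl⟩ _ ⟨x', hx', rfl⟩
    have h₁ := hshadow g hg x hx
    have h₂ := hshadow g' hg' x' hx'
    have h₃ := hr g hg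
    have h₄ := hr g' hg'
    have h₅ := hsep g hg g' hg' hne
    -- Overlapping shadows would force `g o` and `g' o`, both at distance at most `r` from `o`, to
    -- be closer than the separation allows.
    have h₆ : gromovProduct o (g x) (g' x') ≤ r - T - δ - 2 := by
      by_contra hlt
      rw [gromovProduct_comm] at h₁
      have h₇ := hX.le (t := r - T - δ - 2) (g x) (by linarith) (not_le.1 hlt).le
      have h₈ := hX.le (t := r - T - δ - 2 - δ) (g' x') h₇ (by linarith)
      have h₉ := dist_eq_sub_gromovProduct o (g o) (g' o)
      linarith
    have h₇ := dist_eq_sub_gromovProduct o (g x) (g' x')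
    have h₈ := gromovProduct_le_left o (g x) (g o)
    have h₉ := gromovProduct_le_left o (g' x') (g' o)
    exact ⟨h₆, by linarith⟩
  · refine gromovDisjoint_of_lt T ?_
    rintro _ ⟨x, hx, rfl⟩ y hy
    have hy' : T < gromovProduct o y (γ₀⁻¹ o) := not_le.1 hy
    have h₁ := hfar g hg x hx
    -- Otherwise `γ₀ o`, `g x`, `y`, `γ₀⁻¹ o` chain together to give a product of at least `T - 2 *
    -- δ = K + 1` where it is `K`.
    have h₂ : gromovProduct o (g x) y ≤ T := by
      by_contra hlt
      have h₃ := hX.le (t := T) y (not_le.1 hlt).le hy'.le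
      rw [gromovProduct_comm] at h₁
      have h₄ := hX.le (t := T - δ) (g x) (by linarith) h₃
      linarith
    have h₃ := dist_eq_sub_gromovProduct o (g x) y
    have h₄ := gromovProduct_le_left o (g x) (γ₀ o)
    have h₅ := gromovProduct_le_left o y (γ₀⁻¹ o)
    exact ⟨h₂, by linarith⟩

theorem dist_list_prod_apply_le {o : X} {r : ℝ} (l : List (X ≃ᵢ X))
    (hl : ∀ g ∈ l, dist (g o) o ≤ r) : dist (l.prod o) o ≤ l.length * r := by
  induction l with
  | nil => simp
  | cons g t ih =>
    rw [List.prod_cons, IsometryEquiv.mul_apply]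
    have h₁ := dist_triangle (g (t.prod o)) (g o) o
    rw [g.dist_eq] at h₁
    have h₂ := ih fun a ha => hl a (by simp [ha])
    have h₃ := hl g (by simp)
    simp only [List.length_cons]
    push_cast
    linarith

theorem list_prod_mem_closure {M : Type*} [Monoid M] {G : Set M} {l : List M}
    (hl : ∀ g ∈ l, g ∈ G) (hne : l ≠ []) : l.prod ∈ Subsemigroup.closure G := by
  induction l with
  | nil => exact absurd rfl hne
  | cons g t ih =>
    have hg := Subsemigroup.subset_closure (hl g (by simp))
    rcases eq_or_ne t [] with rfl | ht
    · simpa using hg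
    · rw [List.prod_cons]
      exact mul_mem hg (ih (fun a ha => hl a (by simp [ha])) ht)

/-- Growth of a free semigroup of isometries. -/
theorem le_criticalExponent_closure {o : X} {G : Finset (X ≃ᵢ X)} {Y : Set X}
    (hdisj : ∀ g ∈ G, ∀ g' ∈ G, g ≠ g' → Disjoint (g '' Y) (g' '' Y))
    (hsub : ∀ g ∈ G, g '' Y ⊆ Y) (ho : o ∈ Y \ ⋃ g ∈ (G : Set (X ≃ᵢ X)), g '' Y)
    {r : ℕ} (hr : 0 < r) (hGr : ∀ g ∈ G, dist (g o) o ≤ r) {h h' : ℝ} (hh : h < h')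
    (hcard : Real.exp (h' * r) ≤ G.card) :
    (h : EReal) ≤ criticalExponent o (orbit o (Subsemigroup.closure (G : Set (X ≃ᵢ X)))) := by
  have hcount : ∀ k : ℕ, 0 < k → ((G.card ^ k : ℕ) : ENNReal) ≤
      ballCount o (orbit o (Subsemigroup.closure (G : Set (X ≃ᵢ X)))) (k * r + 1 : ℕ) := by
    intro k hk
    set f : (Fin k → G) → X := fun w => (List.ofFn fun i => (w i : X ≃ᵢ X)).prod o with hf
    have hmem : ∀ w : Fin k → G, ∀ g ∈ List.ofFn fun i => (w i : X ≃ᵢ X), g ∈ G := by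
      intro w g hg
      obtain ⟨i, rfl⟩ := (List.mem_ofFn' _ _).1 hg
      exact (w i).2
    have hinj : Function.Injective f := by
      intro w w' hww
      have := List.ofFn_injective (list_eq_of_prod_apply_eq (G := (G : Set (X ≃ᵢ X)))
        hdisj hsub ho ho _ _ (hmem w) (hmem w') hww)
      funext i
      exact Subtype.ext (congrFun this i)
    have hrange : Set.range f ⊆ Metric.ball o ((k * r + 1 : ℕ) : ℝ) ∩
        orbit o (Subsemigroup.closure (G : Set (X ≃ᵢ X))) := by
      rintro _ ⟨w, rfl⟩
      refine ⟨?_, _, list_prod_mem_closure (hmem w) ?_, rfl⟩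
      · have := dist_list_prod_apply_le _ fun g hg => hGr g (hmem w g hg)
        rw [List.length_ofFn] at this
        rw [Metric.mem_ball]
        push_cast
        exact this.trans_lt (lt_add_one _)
      · intro hnil
        have := congrArg List.length hnil
        simp at this
        omega
    have h₁ := Set.encard_le_encard hrange
    rw [← Set.image_univ, hinj.encard_image, Set.encard_univ] at h₁
    have h₂ := ENat.toENNReal_le.2 h₁
    simpa [ballCount, ENat.card_eq_coe_fintype_card] using h₂
  refine le_criticalExponent ?_
  have htend : Tendsto (fun k : ℕ => k * r + 1) atTop atTop :=
    tendsto_atTop_mono (fun k => (Nat.le_mul_of_pos_right k hr).trans (Nat.le_succ _)) tendsto_id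
  -- Radii of the form `k * r + 1` suffice for a limsup; the `+ 1` is there because `ballCount` uses
  -- open balls.
  refine htend.frequently (Eventually.frequently ?_)
  have hlarge : ∀ᶠ k : ℕ in atTop, h ≤ (k : ℝ) * ((h' - h) * r) :=
    (tendsto_natCast_atTop_atTop.atTop_mul_const
      (mul_pos (sub_pos.2 hh) (Nat.cast_pos.2 hr))).eventually_ge_atTop h
  filter_upwards [hlarge, eventually_gt_atTop 0] with k hk hk0
  refine le_trans ?_ (hcount k hk0)
  rw [← ENNReal.ofReal_natCast]
  refine ENNReal.ofReal_le_ofReal ?_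
  push_cast
  refine le_trans ?_ (pow_le_pow_left₀ (Real.exp_pos _).le hcard k)
  rw [← Real.exp_nat_mul]
  refine Real.exp_le_exp.2 ?_
  linarith

/-! ### Rich sets of isometries -/

/-- `F` is a finite part of `A` whose orbit points are `L`-separated and at distance at most `n`
from `o`. -/
structure IsSeparatedFamily (o : X) (A : Set (X ≃ᵢ X)) (L : ℝ) (n : ℕ)
    (F : Finset (X ≃ᵢ X)) : Prop where
  subset : (F : Set (X ≃ᵢ X)) ⊆ A
  dist_le : ∀ γ ∈ F, dist (γ o) o ≤ n
  separated : ∀ γ ∈ F, ∀ γ' ∈ F, γ ≠ γ' → L ≤ dist (γ o) (γ' o)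

theorem IsSeparatedFamily.mono {o : X} {A A' : Set (X ≃ᵢ X)} {L L' : ℝ} {n n' : ℕ}
    {F F' : Finset (X ≃ᵢ X)} (h : IsSeparatedFamily o A L n F) (hF : F' ⊆ F)
    (hA : (F' : Set (X ≃ᵢ X)) ⊆ A') (hL : L' ≤ L) (hn : n ≤ n') :
    IsSeparatedFamily o A' L' n' F' :=
  ⟨hA, fun γ hγ => (h.dist_le γ (hF hγ)).trans (by exact_mod_cast hn),
    fun γ hγ γ' hγ' hne => hL.trans (h.separated γ (hF hγ) γ' (hF hγ') hne)⟩

/-- The orbit of `o` under `A` has exponential growth rate larger than `h`, on every scale of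
separation. -/
def IsRich (o : X) (h : ℝ) (A : Set (X ≃ᵢ X)) : Prop :=
  ∃ h' > h, ∀ L : ℝ, ∃ᶠ n : ℕ in atTop, ∃ F : Finset (X ≃ᵢ X),
    IsSeparatedFamily o A L n F ∧ Real.exp (h' * n) ≤ F.card

/-- The strict inequality `h' > h` in `IsRich` leaves room to absorb a linear factor and a bounded
shift of the radius. -/
theorem IsRich.of_loss {o : X} {h : ℝ} {A B : Set (X ≃ᵢ X)} (hA : IsRich o h A) (a : ℕ)
    (H : ∀ (L : ℝ) (n : ℕ) (F : Finset (X ≃ᵢ X)), IsSeparatedFamily o A L n F →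
      ∃ F', IsSeparatedFamily o B L (n + a) F' ∧ (F.card : ℝ) ≤ (n + 1) * F'.card) :
    IsRich o h B := by
  obtain ⟨h', hh', hA⟩ := hA
  obtain ⟨h'', h₁, h₂⟩ := exists_between hh'
  refine ⟨h'', h₁, fun L => ?_⟩
  refine (tendsto_add_atTop_nat a).frequently
    (((hA L).and_eventually (eventually_exp_le h₂ 1 a)).mono ?_)
  rintro n ⟨⟨F, hF, hcard⟩, hn⟩
  obtain ⟨F', hF', hFF'⟩ := H L n F hF
  refine ⟨F', hF', ?_⟩
  rw [one_mul] at hn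
  exact le_of_mul_le_mul_left (hn.trans (hcard.trans hFF')) (by positivity)

theorem IsRich.exists_of_cover {o : X} {h : ℝ} {A : Set (X ≃ᵢ X)} (hA : IsRich o h A) {ι : Type*}
    (I : Finset ι) (B : ι → Set (X ≃ᵢ X)) (hcov : ∀ γ ∈ A, ∃ i ∈ I, γ ∈ B i) :
    ∃ i ∈ I, IsRich o h (B i) := by
  classical
  by_contra hno
  push Not at hno
  obtain ⟨h', hh', hA⟩ := hA
  obtain ⟨h'', h₁, h₂⟩ := exists_between hh'
  have hex : ∀ i ∈ I, ∃ L : ℝ, ∀ᶠ n : ℕ in atTop, ∀ F : Finset (X ≃ᵢ X),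
      IsSeparatedFamily o (B i) L n F → (F.card : ℝ) ≤ Real.exp (h'' * n) := by
    intro i hi
    by_contra hcon
    refine hno i hi ⟨h'', h₁, fun L => ?_⟩
    push Not at hcon
    exact (hcon L).mono fun n ⟨F, hF, hlt⟩ => ⟨F, hF, hlt.le⟩
  choose! L hL using hex
  -- The sum of the `|L i|` dominates every scale at which a piece fails to be rich, so a family
  -- separated at that scale tests all pieces at once.
  obtain ⟨n, ⟨F, hF, hcard⟩, hn, hall⟩ := ((hA (∑ i ∈ I, |L i|)).and_eventually
    ((eventually_exp_le h₂ (I.card + 1) 0).and ((Finset.eventually_all I).2 hL))).exists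
  have hFsub : F ⊆ I.biUnion fun i => F.filter (· ∈ B i) := by
    intro γ hγ
    obtain ⟨i, hi, hγi⟩ := hcov γ (hF.subset hγ)
    exact Finset.mem_biUnion.2 ⟨i, hi, Finset.mem_filter.2 ⟨hγ, hγi⟩⟩
  have hsum : (F.card : ℝ) ≤ I.card * Real.exp (h'' * n) := by
    have h₃ : (F.card : ℝ) ≤ ∑ i ∈ I, ((F.filter (· ∈ B i)).card : ℝ) := by
      exact_mod_cast (Finset.card_le_card hFsub).trans Finset.card_biUnion_le
    refine h₃.trans ((Finset.sum_le_card_nsmul _ _ _ fun i hi => ?_).trans (nsmul_eq_mul _ _).le)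
    refine hall i hi _ (hF.mono (Finset.filter_subset _ _) ?_ ?_ le_rfl)
    · intro γ hγ
      exact (Finset.mem_filter.1 hγ).2
    · exact (le_abs_self _).trans
        (Finset.single_le_sum (f := fun i => |L i|) (fun _ _ => abs_nonneg _) hi)
  rw [add_zero] at hn
  have h₃ := Real.exp_pos (h'' * n)
  have h₄ : (0 : ℝ) ≤ (I.card + 1) * n * Real.exp (h'' * n) := by positivity
  linarith

theorem not_isRich_of_bounded [ProperSpace X] {o : X} {h : ℝ} (hh : 0 ≤ h) {A : Set (X ≃ᵢ X)}
    {ρ : ℝ} (hA : ∀ γ ∈ A, dist (γ o) o ≤ ρ) : ¬ IsRich o h A := by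
  rintro ⟨h', hh', hrich⟩
  obtain ⟨M, -, hM⟩ := exists_card_le_of_separated o ρ one_pos
  obtain ⟨n, ⟨F, hF, hcard⟩, hn⟩ := ((hrich 1).and_eventually
    (eventually_exp_le (hh.trans_lt hh') (M + 1) 0)).exists
  have h₁ : (F.card : ℝ) ≤ M := by
    exact_mod_cast hM F (fun γ => γ o) (fun γ hγ => hA γ (hF.subset hγ)) hF.separated
  rw [zero_mul, Real.exp_zero] at hn
  have h₂ : (0 : ℝ) ≤ (M + 1) * n := by positivity
  linarith

theorem IsRich.mul_left {o : X} {h : ℝ} {A : Set (X ≃ᵢ X)} (hA : IsRich o h A) (α : X ≃ᵢ X) :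
    IsRich o h ((α * ·) '' A) := by
  classical
  refine hA.of_loss ⌈dist (α o) o⌉₊ fun L n F hF => ⟨F.image (α * ·), ⟨?_, ?_, ?_⟩, ?_⟩
  · rw [Finset.coe_image]
    exact Set.image_mono hF.subset
  · simp only [Finset.forall_mem_image]
    intro γ hγ
    have h₁ := dist_triangle (α (γ o)) (α o) o
    rw [α.dist_eq] at h₁
    have h₂ := hF.dist_le γ hγ
    have h₃ := Nat.le_ceil (dist (α o) o)
    rw [IsometryEquiv.mul_apply]
    push_cast
    linarith
  · simp only [Finset.forall_mem_image, IsometryEquiv.mul_apply, α.dist_eq]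
    exact fun γ hγ γ' hγ' hne => hF.separated γ hγ γ' hγ' fun h => hne (by rw [h])
  · rw [Finset.card_image_of_injective _ (mul_right_injective α)]
    exact le_mul_of_one_le_left (Nat.cast_nonneg _) (by simp)

/-- Pigeonhole on the rounded distance to `o`. The radius `r` found may be much smaller than `n`;
since the rate is nonnegative, the bound in terms of `n` implies the one in terms of `r`. -/
theorem IsRich.exists_annulus {o : X} {h : ℝ} (hh : 0 ≤ h) {A : Set (X ≃ᵢ X)}
    (hA : IsRich o h A) : ∃ h' > h, ∀ L : ℝ, ∃ (r : ℕ) (F : Finset (X ≃ᵢ X)),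
      IsSeparatedFamily o A L r F ∧ (∀ γ ∈ F, (r : ℝ) - 1 ≤ dist (γ o) o) ∧
        Real.exp (h' * r) ≤ F.card := by
  classical
  obtain ⟨h', hh', hA⟩ := hA
  obtain ⟨h'', h₁, h₂⟩ := exists_between hh'
  refine ⟨h'', h₁, fun L => ?_⟩
  obtain ⟨n, ⟨F, hF, hcard⟩, hn⟩ := ((hA L).and_eventually (eventually_exp_le h₂ 1 0)).exists
  obtain ⟨r, hr, hfib⟩ := Finset.exists_le_card_fiber_of_nsmul_le_card_of_maps_to
    (s := F) (t := Finset.range (n + 1)) (f := fun γ => ⌈dist (γ o) o⌉₊)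
    (b := Real.exp (h'' * n))
    (fun γ hγ => Finset.mem_range.2 (Nat.lt_succ_of_le (Nat.ceil_le.2 (hF.dist_le γ hγ))))
    (by simp) (by
      rw [Finset.card_range, nsmul_eq_mul]
      push_cast
      rw [one_mul, add_zero] at hn
      exact hn.trans hcard)
  refine ⟨r, F.filter fun γ => ⌈dist (γ o) o⌉₊ = r, ⟨?_, ?_, ?_⟩, ?_, ?_⟩
  · exact fun γ hγ => hF.subset (Finset.mem_filter.1 hγ).1
  · intro γ hγ
    rw [← (Finset.mem_filter.1 hγ).2]
    exact Nat.le_ceil _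
  · exact fun γ hγ γ' hγ' hne =>
      hF.separated γ (Finset.mem_filter.1 hγ).1 γ' (Finset.mem_filter.1 hγ').1 hne
  · intro γ hγ
    rw [← (Finset.mem_filter.1 hγ).2]
    linarith [Nat.ceil_lt_add_one (dist_nonneg (x := γ o) (y := o))]
  · refine le_trans (Real.exp_le_exp.2 ?_) hfib
    have : (r : ℝ) ≤ n := by exact_mod_cast Nat.lt_succ_iff.1 (Finset.mem_range.1 hr)
    exact mul_le_mul_of_nonneg_left this (hh.trans h₁.le)

theorem isRich_of_lt_entropy [ProperSpace X] {o : X} {Γ : Subsemigroup (X ≃ᵢ X)} {h : ℝ}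
    (hne : (orbit o (Γ : Set (X ≃ᵢ X))).Nonempty)
    (hlt : (h : EReal) < entropy o (orbit o Γ)) : IsRich o h Γ := by
  classical
  rw [entropy, if_neg hne.ne_empty] at hlt
  simp only [lt_iSup_iff] at hlt
  obtain ⟨S, ⟨ε, hε, hS⟩, hlt⟩ := hlt
  obtain ⟨h', hh', hlt'⟩ := EReal.lt_iff_exists_real_btwn.1 hlt
  rw [EReal.coe_lt_coe_iff] at hh'
  obtain ⟨h'', h₁, h₂⟩ := exists_between hh'
  refine ⟨h'', h₁, fun L => ?_⟩
  -- Any ball of this radius about an orbit point is moved by an isometry to one about `o`, so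
  -- passing from scale `ε` to scale `L` costs at most the constant factor `M`.
  obtain ⟨M, hM, hpack⟩ := exists_card_le_of_separated o (max L 1) hε
  refine ((frequently_of_lt_criticalExponent hlt').and_eventually
    (eventually_exp_le h₂ M 0)).mono ?_
  rintro n ⟨hcount, hn⟩
  set P := Metric.ball o (n : ℝ) ∩ (orbit o (Γ : Set (X ≃ᵢ X)) ∩ S) with hP
  obtain ⟨N, -, hN⟩ := exists_card_le_of_separated o n hε
  have hPfin : P.Finite := by
    refine Set.finite_of_encard_le_coe (k := N) (encard_le_of_forall_finset fun F hF => ?_)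
    exact hN F id (fun p hp => Metric.ball_subset_closedBall (hF hp).1)
      fun p hp q hq hpq => (hS p (hF hp).2.2 q (hF hq).2.2 hpq).le
  have hPcard : Real.exp (h' * n) ≤ hPfin.toFinset.card := by
    rw [ballCount, ← hP, hPfin.encard_eq_coe_toFinset_card] at hcount
    have : ENNReal.ofReal (Real.exp (h' * n)) ≤ ((hPfin.toFinset.card : ℕ) : ENNReal) := by
      simpa using hcount
    rw [← ENNReal.ofReal_natCast] at this
    exact (ENNReal.ofReal_le_ofReal_iff (Nat.cast_nonneg _)).1 this
  obtain ⟨T, hTP, hT, hcov⟩ := exists_maximal_separated id P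
    (lt_of_lt_of_le one_pos (le_max_right L 1))
  have hTfin : T.Finite := hPfin.subset hTP
  have hex : ∀ p ∈ P, ∃ γ ∈ Γ, γ o = p := fun p hp => hp.2.1
  have : Nonempty (X ≃ᵢ X) := ⟨1⟩
  choose! γ hγ hγo using hex
  have : Nonempty X := ⟨o⟩
  choose! c hc hpc using hcov
  have hcardle : hPfin.toFinset.card ≤ M * hTfin.toFinset.card := by
    refine Finset.card_le_mul_card_image_of_maps_to (f := c)
      (fun p hp => hTfin.mem_toFinset.2 (hc p (hPfin.mem_toFinset.1 hp))) M fun t ht => ?_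
    have htP : t ∈ P := hTP (hTfin.mem_toFinset.1 ht)
    refine hpack _ (fun p => (γ t)⁻¹ p) (fun p hp => ?_) fun p hp q hq hpq => ?_
    · obtain ⟨hp₁, hp₂⟩ := Finset.mem_filter.1 hp
      have h₃ := hpc p (hPfin.mem_toFinset.1 hp₁)
      rw [hp₂] at h₃
      rw [Metric.mem_closedBall, dist_inv_apply, hγo t htP]
      exact h₃.le
    · rw [((γ t)⁻¹).dist_eq]
      exact (hS p (hPfin.mem_toFinset.1 (Finset.mem_filter.1 hp).1).2.2 q
        (hPfin.mem_toFinset.1 (Finset.mem_filter.1 hq).1).2.2 hpq).le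
  have hinj : Set.InjOn γ T := by
    intro p hp q hq hpq
    rw [← hγo p (hTP hp), ← hγo q (hTP hq), hpq]
  refine ⟨hTfin.toFinset.image γ, ⟨?_, ?_, ?_⟩, ?_⟩
  · intro g hg
    obtain ⟨p, hp, rfl⟩ := Finset.mem_image.1 hg
    exact hγ p (hTP (hTfin.mem_toFinset.1 hp))
  · simp only [Finset.forall_mem_image, Set.Finite.mem_toFinset]
    intro p hp
    rw [hγo p (hTP hp)]
    exact (Metric.mem_ball.1 (hTP hp).1).le
  · simp only [Finset.forall_mem_image, Set.Finite.mem_toFinset]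
    intro p hp q hq hpq
    rw [hγo p (hTP hp), hγo q (hTP hq)]
    exact (le_max_left L 1).trans (hT p hp q hq fun h => hpq (by rw [h]))
  · rw [Finset.card_image_of_injOn (by simpa using hinj)]
    have h₃ : (hPfin.toFinset.card : ℝ) ≤ M * hTfin.toFinset.card := by exact_mod_cast hcardle
    have hM' : (0 : ℝ) < M := by exact_mod_cast hM
    rw [add_zero] at hn
    have h₄ : (M : ℝ) * Real.exp (h'' * n) ≤ M * (n + 1) * Real.exp (h'' * n) :=
      mul_le_mul_of_nonneg_right (le_mul_of_one_le_right hM'.le (by simp)) (Real.exp_pos _).le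
    exact le_of_mul_le_mul_left (h₄.trans (hn.trans (hPcard.trans h₃))) hM'

/-- Partition by the cover members containing `γ o` and `γ⁻¹ o`; a rich cell cannot involve a
bounded member. -/
theorem IsRich.exists_concentrated [ProperSpace X] {o : X} {δ : ℝ} (hX : IsHyperbolicWith o δ)
    [CompactSpace (GromovClosure o)] {h : ℝ} (hh : 0 ≤ h) {A : Set (X ≃ᵢ X)} (hA : IsRich o h A)
    (R : ℝ) : ∃ B ⊆ A, IsRich o h B ∧ IsConcentrated o R B := by
  classical
  obtain ⟨𝒰, hfin, hcov, h𝒰⟩ := hX.exists_finite_cover R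
  obtain ⟨⟨U, V⟩, hUV, hrich⟩ := hA.exists_of_cover (hfin.toFinset ×ˢ hfin.toFinset)
    (fun i => {γ ∈ A | γ o ∈ i.1 ∧ γ⁻¹ o ∈ i.2}) (by
      intro γ hγ
      obtain ⟨U, hU, hU'⟩ := hcov (γ o)
      obtain ⟨V, hV, hV'⟩ := hcov (γ⁻¹ o)
      exact ⟨(U, V), by simp [hU, hV], hγ, hU', hV'⟩)
  simp only [Finset.mem_product, Set.Finite.mem_toFinset] at hUV
  rcases h𝒰 U hUV.1 with ⟨ρ, hρ⟩ | hU
  · exact absurd hrich (not_isRich_of_bounded hh (ρ := ρ) fun γ hγ => hρ hγ.2.1)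
  rcases h𝒰 V hUV.2 with ⟨ρ, hρ⟩ | hV
  · refine absurd hrich (not_isRich_of_bounded hh (ρ := ρ) fun γ hγ => ?_)
    rw [← dist_inv_apply_base]
    exact hρ hγ.2.2
  · exact ⟨_, fun γ hγ => hγ.1, hrich, fun γ hγ γ' hγ' =>
      ⟨hU _ hγ.2.1 _ hγ'.2.1, hV _ hγ.2.2 _ hγ'.2.2⟩⟩

/-- If `α` brings the points outside `W` closer to `o`, then moving by powers of `α` makes a
rich semigroup rich within `W`. -/
theorem IsRich.of_contraction {o : X} {h : ℝ} {Γ : Subsemigroup (X ≃ᵢ X)} {α : X ≃ᵢ X}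
    (hα : α ∈ Γ) {W : Set X} (hW : ∀ x ∉ W, dist (α x) o ≤ dist x o - 1)
    (hΓ : IsRich o h (Γ : Set (X ≃ᵢ X))) : IsRich o h {γ | γ ∈ Γ ∧ γ o ∈ W} := by
  classical
  -- Each application of `α` outside `W` gains distance 1, so at most `n` powers are needed; fixing
  -- the commonest exponent costs a factor `n + 1`.
  have hpow : ∀ (m : ℕ) (x : X), dist x o ≤ m →
      ∃ k ≤ m, (α ^ k) x ∈ W ∧ dist ((α ^ k) x) o ≤ dist x o := by
    intro m
    induction m with
    | zero =>
      intro x hx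
      refine ⟨0, le_rfl, ?_, by simp⟩
      by_contra hxW
      have h₁ := hW x (by simpa using hxW)
      have h₂ := dist_nonneg (x := α x) (y := o)
      simp only [Nat.cast_zero] at hx
      linarith
    | succ m ih =>
      intro x hx
      by_cases hxW : x ∈ W
      · exact ⟨0, Nat.zero_le _, by simpa using hxW, by simp⟩
      · have h₁ := hW x hxW
        push_cast at hx
        obtain ⟨k, hk, hkW, hkd⟩ := ih (α x) (by linarith)
        refine ⟨k + 1, Nat.succ_le_succ hk, ?_, ?_⟩
        · rwa [pow_succ, IsometryEquiv.mul_apply]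
        · rw [pow_succ, IsometryEquiv.mul_apply]
          linarith
  have hmem : ∀ (k : ℕ), ∀ γ ∈ Γ, α ^ k * γ ∈ Γ := by
    intro k γ hγ
    induction k with
    | zero => simpa using hγ
    | succ k ih =>
      rw [pow_succ', mul_assoc]
      exact mul_mem hα ih
  refine hΓ.of_loss 0 fun L n F hF => ?_
  have hex : ∀ γ ∈ F, ∃ k ≤ n, (α ^ k) (γ o) ∈ W ∧ dist ((α ^ k) (γ o)) o ≤ dist (γ o) o :=
    fun γ hγ => hpow n (γ o) (hF.dist_le γ hγ)
  choose! k hkn hkW hkd using hex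
  obtain ⟨m, -, hfib⟩ := Finset.exists_le_card_fiber_of_nsmul_le_card_of_maps_to
    (s := F) (t := Finset.range (n + 1)) (f := k) (b := (F.card : ℝ) / (n + 1))
    (fun γ hγ => Finset.mem_range.2 (Nat.lt_succ_of_le (hkn γ hγ))) (by simp) (by
      rw [Finset.card_range, nsmul_eq_mul]
      push_cast
      rw [mul_div_cancel₀]
      positivity)
  refine ⟨(F.filter fun γ => k γ = m).image (α ^ m * ·), ⟨?_, ?_, ?_⟩, ?_⟩
  · intro g hg
    obtain ⟨γ, hγ, rfl⟩ := Finset.mem_image.1 hg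
    obtain ⟨hγF, rfl⟩ := Finset.mem_filter.1 hγ
    exact ⟨hmem _ _ (hF.subset hγF), hkW γ hγF⟩
  · simp only [Finset.forall_mem_image, Finset.mem_filter]
    rintro γ ⟨hγ, rfl⟩
    exact (hkd γ hγ).trans (hF.dist_le γ hγ)
  · simp only [Finset.forall_mem_image, Finset.mem_filter, IsometryEquiv.mul_apply,
      (α ^ m).dist_eq]
    exact fun γ hγ γ' hγ' hne => hF.separated γ hγ.1 γ' hγ'.1 fun h => hne (by rw [h])
  · rw [Finset.card_image_of_injective _ (mul_right_injective _)]
    rwa [div_le_iff₀' (by positivity)] at hfib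

/-! ### Schottky semigroups from ping-pong, and consequences of two limit points -/

theorem IsHyperbolicWith.exists_isSchottky_of_isRich {o : X} {δ : ℝ} (hX : IsHyperbolicWith o δ)
    {Γ : Subsemigroup (X ≃ᵢ X)} {h : ℝ} (hh : 0 ≤ h) {R : ℝ} {B : Set (X ≃ᵢ X)}
    (hBΓ : B ⊆ Γ) (hrich : IsRich o h B) (hB : IsConcentrated o R B) {γ₀ : X ≃ᵢ X} (hγ₀ : γ₀ ∈ B)
    (hR : 2 * gromovProduct o (γ₀ o) (γ₀⁻¹ o) + 6 * δ + 3 ≤ R) :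
    ∃ Γ' ≤ Γ, IsSchottky o Γ' ∧ (h : EReal) ≤ criticalExponent o (orbit o Γ') := by
  obtain ⟨h', hh', hann⟩ := hrich.exists_annulus hh
  obtain ⟨r, F, hF, hFr, hcard⟩ := hann (2 * gromovProduct o (γ₀ o) (γ₀⁻¹ o) + 10 * δ + 8)
  obtain ⟨Y, hball, hdisj, hcompl⟩ := hX.exists_pingPong_domain hB hF.subset hγ₀ hR
    (fun g hg => ⟨hFr g hg, hF.dist_le g hg⟩) hF.separated
  have hFne : F.Nonempty := by
    rw [← Finset.card_pos]
    exact_mod_cast (Real.exp_pos _).trans_le hcard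
  have hr : 0 < r := by
    obtain ⟨g, hg⟩ := hFne
    have h₁ := hB.le_dist (hF.subset hg)
    have h₂ := hF.dist_le g hg
    have h₃ := gromovProduct_nonneg o (γ₀ o) (γ₀⁻¹ o)
    have h₄ := hX.1
    have : (0 : ℝ) < r := by linarith
    exact_mod_cast this
  refine ⟨Subsemigroup.closure F, Subsemigroup.closure_le.2 (hF.subset.trans hBΓ),
    ⟨Y, F, F.finite_toSet, hFne, rfl, hdisj, hcompl, o, ?_⟩, ?_⟩
  · exact interior_maximal hball Metric.isOpen_ball (Metric.mem_ball_self one_pos)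
  · exact le_criticalExponent_closure
      (fun g hg g' hg' hne => (hdisj g hg g' hg' hne).1.mono subset_closure subset_closure)
      (fun g hg => Set.disjoint_compl_right_iff_subset.1
        ((hcompl g hg).1.mono subset_closure subset_closure))
      (hball (Metric.mem_ball_self one_pos)) hr hF.dist_le hh' hcard

theorem IsHyperbolicWith.exists_isSchottky_of_mem {o : X} {δ : ℝ} (hX : IsHyperbolicWith o δ)
    {Γ : Subsemigroup (X ≃ᵢ X)} {g : X ≃ᵢ X} (hg : g ∈ Γ)
    (hgR : 2 * gromovProduct o (g o) (g⁻¹ o) + 6 * δ + 3 ≤ dist (g o) o) :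
    ∃ Γ' ≤ Γ, IsSchottky o Γ' ∧ 0 ≤ criticalExponent o (orbit o Γ') := by
  have hB : IsConcentrated o (dist (g o) o) {g} := by
    rintro _ rfl _ rfl
    rw [gromovProduct_self, gromovProduct_self, dist_inv_apply_base]
    exact ⟨le_rfl, le_rfl⟩
  obtain ⟨Y, hball, hdisj, hcompl⟩ := hX.exists_pingPong_domain (r := dist (g o) o) hB
    subset_rfl rfl hgR (by rintro _ rfl; exact ⟨by linarith, le_rfl⟩)
    (by rintro _ rfl _ rfl hne; exact absurd rfl hne)
  refine ⟨Subsemigroup.closure {g}, Subsemigroup.closure_le.2 (by simpa using hg),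
    ⟨Y, {g}, Set.finite_singleton g, Set.singleton_nonempty g, rfl, hdisj, hcompl, o, ?_⟩, ?_⟩
  · exact interior_maximal hball Metric.isOpen_ball (Metric.mem_ball_self one_pos)
  · exact criticalExponent_nonneg ⟨g o, g, Subsemigroup.subset_closure rfl, rfl⟩

theorem ConvergentSeq.exists_forall_ge {o : X} (u : ConvergentSeq o) (R : ℝ) :
    ∃ N, ∀ i ≥ N, ∀ j ≥ N, R ≤ gromovProduct o (u.1 i) (u.1 j) := by
  obtain ⟨⟨a, b⟩, h⟩ := eventually_atTop.1 (u.2.eventually_ge_atTop R)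
  exact ⟨max a b, fun i hi j hj =>
    h (i, j) ⟨(le_max_left a b).trans hi, (le_max_right a b).trans hj⟩⟩

theorem IsHyperbolicWith.exists_forall_le_of_not_seqEquiv {o : X} {δ : ℝ}
    (hX : IsHyperbolicWith o δ) {u v : ConvergentSeq o} (h : ¬ SeqEquiv o u v) :
    ∃ (K : ℝ) (N : ℕ), ∀ i ≥ N, ∀ j ≥ N, gromovProduct o (u.1 i) (v.1 j) ≤ K := by
  unfold SeqEquiv at h
  rw [tendsto_atTop] at h
  push Not at h
  obtain ⟨K, hK⟩ := h
  obtain ⟨N₁, hN₁⟩ := u.exists_forall_ge (K + 2 * δ)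
  obtain ⟨N₂, hN₂⟩ := v.exists_forall_ge (K + 2 * δ)
  refine ⟨K + 2 * δ, max N₁ N₂, fun i hi j hj => ?_⟩
  by_contra hlt
  obtain ⟨⟨a, b⟩, hab, hlt'⟩ := (frequently_atTop.1 hK) (N₁, N₂)
  have h₁ := hX.le _ (hN₁ a hab.1 i ((le_max_left _ _).trans hi)) (not_le.1 hlt).le
  have h₂ := hX.le (t := K + 2 * δ - δ) _ h₁
    ((by linarith [hX.1] : K + 2 * δ - δ ≤ K + 2 * δ).trans
      (hN₂ j ((le_max_right _ _).trans hj) b hab.2))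
  simp only at hlt'
  linarith

theorem exists_convergentSeq_of_nontrivial {o : X} {Γ : Subsemigroup (X ≃ᵢ X)}
    (hΓ : (limitSet o Γ).Nontrivial) : ∃ u v : ConvergentSeq o,
      (∀ n, ∃ γ ∈ Γ, γ o = u.1 n) ∧ (∀ n, ∃ γ ∈ Γ, γ o = v.1 n) ∧ ¬ SeqEquiv o u v := by
  obtain ⟨_, ⟨u, hu, rfl⟩, _, ⟨v, hv, rfl⟩, hne⟩ := hΓ
  exact ⟨u, v, hu, hv, fun h => hne (Quot.sound h)⟩

/-- A semigroup with two limit points contains an isometry whose orbit points in forward and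
backward direction are far from `o` and from each other. -/
theorem IsHyperbolicWith.exists_mem_of_limitSet_nontrivial {o : X} {δ : ℝ}
    (hX : IsHyperbolicWith o δ) {Γ : Subsemigroup (X ≃ᵢ X)} (hΓ : (limitSet o Γ).Nontrivial) :
    ∃ g ∈ Γ, 2 * gromovProduct o (g o) (g⁻¹ o) + 6 * δ + 3 ≤ dist (g o) o := by
  by_contra hno
  push Not at hno
  have hδ := hX.1
  -- Take `γ o`, `η o` far out in different directions. If neither `γ` nor `η` works, `γ⁻¹ o` points
  -- towards `γ o` and `η⁻¹ o` towards `η o`; then `γ η o` points towards `γ o` and its inverse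
  -- counterpart towards `η o`, so `γ * η` works.
  obtain ⟨u, v, hu, hv, huv⟩ := exists_convergentSeq_of_nontrivial hΓ
  obtain ⟨K, N, hK⟩ := hX.exists_forall_le_of_not_seqEquiv huv
  set R := 3 * K + 26 * δ + 8 with hR
  obtain ⟨N₁, hN₁⟩ := u.exists_forall_ge R
  obtain ⟨N₂, hN₂⟩ := v.exists_forall_ge R
  set n := max N (max N₁ N₂) with hn
  have hnN : N ≤ n := le_max_left _ _
  have hnN₁ : N₁ ≤ n := (le_max_left _ _).trans (le_max_right _ _)
  have hnN₂ : N₂ ≤ n := (le_max_right _ _).trans (le_max_right _ _)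
  have h₁ := hK n hnN n hnN
  have h₂ := hN₁ n hnN₁ n hnN₁
  have h₃ := hN₂ n hnN₂ n hnN₂
  obtain ⟨γ, hγ, hγu⟩ := hu n
  obtain ⟨η, hη, hηv⟩ := hv n
  rw [← hγu, ← hηv] at h₁
  rw [← hγu, gromovProduct_self] at h₂
  rw [← hηv, gromovProduct_self] at h₃
  have hK0 := gromovProduct_nonneg o (γ o) (η o)
  have h₄ := hno γ hγ
  have h₅ := hno η hη
  have h₆ := hno (γ * η) (mul_mem hγ hη)
  rw [mul_inv_rev, IsometryEquiv.mul_apply, IsometryEquiv.mul_apply] at h₆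
  have h₇ : gromovProduct o (γ⁻¹ o) (η o) ≤ K + δ + 1 := by
    by_contra hlt
    have := hX.le (t := K + δ + 1) (γ⁻¹ o) (by linarith : _ ≤ gromovProduct o (γ o) (γ⁻¹ o))
      (not_le.1 hlt).le
    linarith
  have h₈ := gromovProduct_map_add o γ (η o)
  have h₉ := gromovProduct_map_add o η⁻¹ (γ⁻¹ o)
  rw [gromovProduct_comm o (η o)] at h₈
  rw [inv_inv, dist_inv_apply_base] at h₉
  have h₁₀ := gromovProduct_le_left o (γ (η o)) (γ o)
  have h₁₁ : gromovProduct o (γ (η o)) (η⁻¹ (γ⁻¹ o)) ≤ K + 3 * δ + 1 := by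
    by_contra hlt
    have h₁₂ := hX.le (t := K + 3 * δ + 1) (γ (η o))
      (by rw [gromovProduct_comm]; linarith : _ ≤ gromovProduct o (γ o) _) (not_le.1 hlt).le
    have h₁₃ := hX.le (t := K + 3 * δ + 1) (η⁻¹ o)
      (by linarith : _ ≤ gromovProduct o (η⁻¹ (γ⁻¹ o)) (η⁻¹ o))
      (by rw [gromovProduct_comm]; linarith : _ ≤ gromovProduct o _ (η o))
    have h₁₄ := hX.le (t := K + 3 * δ + 1 - δ) _ h₁₂ h₁₃
    linarith
  linarith

theorem IsRich.nonempty {o : X} {h : ℝ} {A : Set (X ≃ᵢ X)} (hA : IsRich o h A) : A.Nonempty := by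
  obtain ⟨h', -, hA⟩ := hA
  obtain ⟨n, F, hF, hcard⟩ := (hA 0).exists
  have hne : F.Nonempty := by
    rw [← Finset.card_pos]
    exact_mod_cast (Real.exp_pos _).trans_le hcard
  obtain ⟨γ, hγ⟩ := hne
  exact ⟨γ, hF.subset hγ⟩

/-- Lets the argument for `B` be repeated for its translates, which is how every element of `Γ` is
seen to fix the limit direction. -/
theorem IsConcentrated.mul_left {o : X} {R : ℝ} {B : Set (X ≃ᵢ X)} (hB : IsConcentrated o R B)
    (α : X ≃ᵢ X) : IsConcentrated o (R - 2 * dist (α o) o) ((α * ·) '' B) := by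
  rintro _ ⟨γ, hγ, rfl⟩ _ ⟨γ', hγ', rfl⟩
  simp only [mul_inv_rev, IsometryEquiv.mul_apply]
  obtain ⟨h₁, h₂⟩ := hB γ hγ γ' hγ'
  have h₃ := gromovProduct_le_map o α (γ o) (γ' o)
  have h₄ := gromovProduct_le_add_dist_left o (γ⁻¹ o) (γ⁻¹ (α⁻¹ o)) (γ'⁻¹ o)
  have h₅ := gromovProduct_le_add_dist_right o (γ⁻¹ (α⁻¹ o)) (γ'⁻¹ o) (γ'⁻¹ (α⁻¹ o))
  rw [(γ⁻¹).dist_eq, dist_comm, dist_inv_apply_base] at h₄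
  rw [(γ'⁻¹).dist_eq, dist_comm, dist_inv_apply_base] at h₅
  have h₆ := dist_nonneg (x := α o) (y := o)
  constructor <;> linarith

theorem IsRich.exists_antitone_concentrated [ProperSpace X] {o : X} {δ : ℝ}
    (hX : IsHyperbolicWith o δ) [CompactSpace (GromovClosure o)] {h : ℝ} (hh : 0 ≤ h)
    {A : Set (X ≃ᵢ X)} (hA : IsRich o h A) :
    ∃ B : ℕ → Set (X ≃ᵢ X), Antitone B ∧
      ∀ n, B n ⊆ A ∧ IsRich o h (B n) ∧ IsConcentrated o n (B n) := by
  have hstep : ∀ (n : ℕ) (D : {D : Set (X ≃ᵢ X) // D ⊆ A ∧ IsRich o h D}),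
      ∃ E : {D : Set (X ≃ᵢ X) // D ⊆ A ∧ IsRich o h D}, E.1 ⊆ D.1 ∧ IsConcentrated o n E.1 := by
    rintro n ⟨D, hDA, hD⟩
    obtain ⟨E, hED, hE, hEn⟩ := hD.exists_concentrated hX hh n
    exact ⟨⟨E, hED.trans hDA, hE⟩, hED, hEn⟩
  choose f hf₁ hf₂ using hstep
  let s : ℕ → {D : Set (X ≃ᵢ X) // D ⊆ A ∧ IsRich o h D} := fun n =>
    Nat.rec (f 0 ⟨A, subset_rfl, hA⟩) (fun n D => f (n + 1) D) n
  refine ⟨fun n => (s n).1, antitone_nat_of_succ_le fun n => hf₁ (n + 1) (s n), fun n =>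
    ⟨(s n).2.1, (s n).2.2, ?_⟩⟩
  cases n with
  | zero => exact hf₂ 0 _
  | succ n => exact hf₂ (n + 1) (s n)

/-! ### The case of a common direction, and the lower bound -/

theorem IsHyperbolicWith.exists_isSchottky_le_criticalExponent [ProperSpace X] {o : X} {δ : ℝ}
    (hX : IsHyperbolicWith o δ) [CompactSpace (GromovClosure o)] {Γ : Subsemigroup (X ≃ᵢ X)}
    (hΓ : (limitSet o Γ).Nontrivial) {h : ℝ} (hh : 0 ≤ h)
    (hrich : IsRich o h (Γ : Set (X ≃ᵢ X))) :
    ∃ Γ' ≤ Γ, IsSchottky o Γ' ∧ (h : EReal) ≤ criticalExponent o (orbit o Γ') := by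
  by_contra hno
  have hδ := hX.1
  have hclose : ∀ (R : ℝ) (B : Set (X ≃ᵢ X)), B ⊆ Γ → IsRich o h B → IsConcentrated o R B →
      ∀ γ ∈ B, R < 2 * gromovProduct o (γ o) (γ⁻¹ o) + 6 * δ + 3 := by
    intro R B hBΓ hBr hB γ hγ
    by_contra hlt
    exact hno (hX.exists_isSchottky_of_isRich hh hBΓ hBr hB hγ (not_lt.1 hlt))
  obtain ⟨B, hanti, hB⟩ := hrich.exists_antitone_concentrated hX hh
  have hne : ∀ n, ∃ γ, γ ∈ B n := fun n => (hB n).2.1.nonempty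
  choose γ hγ using hne
  have hγge : ∀ n : ℕ, ∀ i ≥ n, ∀ j ≥ n, (n : ℝ) ≤ gromovProduct o (γ i o) (γ j o) :=
    fun n i hi j hj => ((hB n).2.2 _ (hanti hi (hγ i)) _ (hanti hj (hγ j))).1
  let p : ConvergentSeq o := ⟨fun n => γ n o, by
    refine tendsto_atTop.2 fun R => eventually_atTop.2 ⟨(⌈R⌉₊, ⌈R⌉₊), fun q hq => ?_⟩
    exact (Nat.le_ceil R).trans (hγge _ _ hq.1 _ hq.2)⟩
  -- Every `α` fixes the limit `p`: by `hclose` for `B n` and for its translate by `α`, both `γ n o`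
  -- and `α (γ n o)` point towards `(γ n)⁻¹ o`.
  have hfix : ∀ α ∈ Γ, ∀ R : ℝ, ∀ᶠ n in atTop, R ≤ gromovProduct o (α (γ n o)) (γ n o) := by
    intro α hα R
    filter_upwards [eventually_ge_atTop
      ⌈2 * (R + δ) + 4 * dist (α o) o + 6 * δ + 3⌉₊] with n hn
    have h₀ : 2 * (R + δ) + 4 * dist (α o) o + 6 * δ + 3 ≤ n := Nat.ceil_le.1 hn
    have h₁ := hclose n (B n) (hB n).1 (hB n).2.1 (hB n).2.2 _ (hγ n)
    have h₂ := hclose _ _ (by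
      rintro _ ⟨β, hβ, rfl⟩
      exact mul_mem hα ((hB n).1 hβ)) ((hB n).2.1.mul_left α) ((hB n).2.2.mul_left α) _
      ⟨_, hγ n, rfl⟩
    simp only [mul_inv_rev, IsometryEquiv.mul_apply] at h₂
    have h₃ := gromovProduct_le_add_dist_right o (α (γ n o)) ((γ n)⁻¹ (α⁻¹ o)) ((γ n)⁻¹ o)
    rw [((γ n)⁻¹).dist_eq, dist_inv_apply_base] at h₃
    have h₄ := dist_nonneg (x := α o) (y := o)
    have h₅ := hX.le (t := R + δ) (z := γ n o) ((γ n)⁻¹ o)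
      (by linarith : _ ≤ gromovProduct o (α (γ n o)) _)
      (by rw [gromovProduct_comm]; linarith)
    linarith
  have hp : ∃ u : ConvergentSeq o, (∀ n, ∃ α ∈ Γ, α o = u.1 n) ∧ ¬ SeqEquiv o u p := by
    obtain ⟨u, v, hu, hv, huv⟩ := exists_convergentSeq_of_nontrivial hΓ
    have heq := seqEquiv_equivalence (o := o) ⟨δ, hX⟩
    by_cases hup : SeqEquiv o u p
    · exact ⟨v, hv, fun hvp => huv (heq.trans hup (heq.symm hvp))⟩
    · exact ⟨u, hu, hup⟩
  obtain ⟨u, hu, hup⟩ := hp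
  obtain ⟨K, N, hK⟩ := hX.exists_forall_le_of_not_seqEquiv hup
  obtain ⟨N₁, hN₁⟩ := u.exists_forall_ge (2 * K + 4 * δ + 4)
  obtain ⟨α, hα, hαu⟩ := hu (max N N₁)
  have hαK : ∀ᶠ m in atTop, gromovProduct o (α o) (γ m o) ≤ K := by
    filter_upwards [eventually_ge_atTop N] with m hm
    rw [hαu]
    exact hK _ (le_max_left _ _) m hm
  have hαlarge : 2 * K + 4 * δ + 4 ≤ dist (α o) o := by
    rw [hαu, ← gromovProduct_self]
    exact hN₁ _ (le_max_right _ _) _ (le_max_right _ _)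
  -- A product `(x|α⁻¹ o)` of at least half of `dist (α o) o` plus 1 makes `α` bring `x` closer to
  -- `o`; the `δ` pays for comparing `x` with `α⁻¹ o` through `γ m o`.
  set K' := dist (α o) o / 2 + δ + 1 with hK'
  have hrich' := hrich.of_contraction hα
    (W := {x | ∀ᶠ m in atTop, gromovProduct o x (γ m o) ≤ K'}) (by
      intro x hx
      obtain ⟨m, hxm, hαm, hfm⟩ := (not_eventually.1 hx |>.and_eventually
        (hαK.and (hfix α hα (K + δ + 1)))).exists
      have h₁ : gromovProduct o (α (γ m o)) (α o) ≤ K + δ + 1 := by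
        by_contra hlt
        rw [gromovProduct_comm] at hlt
        have := hX.le (t := K + δ + 1) _ (not_le.1 hlt).le hfm
        linarith
      have h₂ := gromovProduct_map_add o α (γ m o)
      have h₃ := hX.le (t := K') _ (not_le.1 hxm).le
        (by linarith : K' ≤ gromovProduct o (γ m o) (α⁻¹ o))
      have h₄ := dist_eq_sub_gromovProduct o x (α⁻¹ o)
      rw [dist_comm x, dist_inv_apply, dist_inv_apply_base, dist_comm o] at h₄
      linarith)
  have hK'0 : 0 ≤ K' := by positivity
  obtain ⟨D, hD, hDrich, hDc⟩ := hrich'.exists_concentrated hX hh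
    (2 * K' + 8 * δ + 5)
  obtain ⟨β, hβ⟩ := hDrich.nonempty
  have h₁ := hclose _ D (fun g hg => (hD hg).1) hDrich hDc β hβ
  have h₂ := hDc.le_dist hβ
  -- Here `β o`, hence `β⁻¹ o`, is away from `γ m o`, so `β (γ m o)` points towards `β o`; but it
  -- also points towards `γ m o`, which contradicts `hm₁`.
  obtain ⟨m, hm₁, hm₂⟩ := ((hD hβ).2.and (hfix β (hD hβ).1 (K' + δ + 1))).exists
  have h₃ : gromovProduct o (γ m o) (β⁻¹ o) ≤ K' + δ + 1 := by
    by_contra hlt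
    rw [gromovProduct_comm] at hlt
    have := hX.le (t := K' + δ + 1) (β⁻¹ o) (by linarith : _ ≤ gromovProduct o (β o) _)
      (not_le.1 hlt).le
    linarith
  have h₄ := gromovProduct_map_add o β (γ m o)
  have h₅ := hX.le (t := K' + δ + 1) (β (γ m o))
    (by rw [gromovProduct_comm]; linarith : _ ≤ gromovProduct o (β o) _) hm₂
  linarith

end GromovHyp

theorem mainTheorem1 {X : Type*} [MetricSpace X] (o : X)
    (hX : GromovHyp.IsGromovHyperbolic o)
    (hc : CompactSpace (GromovHyp.GromovClosure o))
    (Γ : Subsemigroup (X ≃ᵢ X))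
    (hΓ : (GromovHyp.limitSet o Γ).Nontrivial) :
    (⨆ (Γ' : Subsemigroup (X ≃ᵢ X)) (_ : Γ' ≤ Γ) (_ : GromovHyp.IsSchottky o Γ'),
      GromovHyp.criticalExponent o (GromovHyp.orbit o Γ')) =
    GromovHyp.entropy o (GromovHyp.orbit o Γ) := by
  have : ProperSpace X := GromovHyp.properSpace_of_compactSpace_gromovClosure o
  obtain ⟨δ, hδ⟩ := hX
  have hyp : GromovHyp.IsHyperbolicWith o δ := hδ
  obtain ⟨g, hg, hgR⟩ := hyp.exists_mem_of_limitSet_nontrivial hΓ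
  refine le_antisymm (iSup_le fun Γ' => iSup₂_le fun hΓ' hS =>
    hS.criticalExponent_le_entropy hΓ') (le_of_forall_lt fun c hc => ?_)
  obtain ⟨h, hch, hh⟩ := EReal.lt_iff_exists_real_btwn.1 hc
  have key : ∃ Γ' ≤ Γ, GromovHyp.IsSchottky o Γ' ∧
      (h : EReal) ≤ GromovHyp.criticalExponent o (GromovHyp.orbit o Γ') := by
    -- Richness is used only at nonnegative rates: a bounded set can be rich at a negative one.
    rcases le_or_gt 0 h with h0 | h0
    · exact hyp.exists_isSchottky_le_criticalExponent hΓ h0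
        (GromovHyp.isRich_of_lt_entropy ⟨g o, g, hg, rfl⟩ hh)
    · obtain ⟨Γ', hle, hS, hpos⟩ := hyp.exists_isSchottky_of_mem hg hgR
      exact ⟨Γ', hle, hS, le_trans (by exact_mod_cast h0.le) hpos⟩
  obtain ⟨Γ', hle, hS, hge⟩ := key
  exact (hch.trans_le hge).trans_le
    (le_iSup_of_le Γ' (le_iSup₂_of_le hle hS le_rfl))
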